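/- Link diagrams are finite planar diagrams, and regions are the components of the complement of the diagram in the plane, the unbounded one included. For a diagram $D$ let $\langle D\rangle\in\mathbb Z[A^{\pm1}]$ be the Kauffman bracket, $$\langle D\rangle=\sum_s A^{\sigma(s)}(-A^2-A^{-2})^{|D_s|-1},$$ where $s$ runs over all functions from the crossings of $D$ to $\{+1,-1\}$, $\sigma(s)=\sum_p s(p)$, and $|D_s|$ is the number of circles obtained by smoothing every crossing $p$ according to the marker $s(p)$; the positive marker joins the two corners at $p$ that are swept out by the upper strand when it is turned counterclockwise, the negative marker joins the other two. Let $D^p_0$ and $D^p_\infty$ be the diagrams obtained from $D$ by smoothing only the crossing $p$ with the positive, respectively negative, marker (so $\langle D\rangle=A\langle D^p_0\rangle+A^{-1}\langle D^p_\infty\rangle$). For an oriented diagram $\vec D$ of writhe $w$ let $Det_{\vec D}=V_{\vec D}(-1)$ be the value of $(-A^3)^{-w}\langle D\rangle$ at $A=e^{-\pi i/4}$; $|Det_D|$ does not depend on the orientation. The standard shading of an alternating diagram is the checkerboard coloring of its regions in which the black corners at each crossing are those swept out by the upper strand when it is turned counterclockwise. Links are considered up to isotopy, i.e. diagrams up to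 Reidemeister moves. A link is non-split if all its diagrams are connected. The family of quasi-alternating links is the smallest family of links that contains the trivial knot and contains every link $L$ having a diagram $D$ with a crossing $p$ such that the links of $D^p_0$ and $D^p_\infty$ belong to the family and $|Det_D|=|Det_{D^p_0}|+|Det_{D^p_\infty}|$. **Lemma.** Let $A$ be a complex number with $A^4=-1$, and evaluate brackets at $A$. 1. Every connected alternating diagram $D$ has a standard shading, and for every standard shading, with $B$ black and $W$ white regions, $$\langle D\rangle=A^{B-W}\,|\langle D\rangle| .$$ 2. For every alternating diagram $D$ (connected or not) and every crossing $p$ of $D$, $$|\langle D\rangle|=|\langle D^p_0\rangle|+|\langle D^p_\infty\rangle| ,$$ and $|Det_D|=|Det_{D^p_0}|+|Det_{D^p_\infty}|$. 3. Every non-split link that has an alternating diagram is quasi-alternating. -/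

import Mathlib

open scoped LaurentPolynomial

/-! ### Link diagrams

A (finite, unoriented) link diagram is encoded by the cyclically ordered ends of edges at its
vertices.  There are two kinds of vertices: the crossings, which have four ends, and the
"bivalent" points of the diagram, which are ordinary points on a strand (the corners of a
polygonal link).  At a crossing `c` the ends `(c, 0), (c, 1), (c, 2), (c, 3)` are listed
counterclockwise; `(c, 0), (c, 2)` lie on the lower strand and `(c, 1), (c, 3)` lie on the upper
strand.  The involution `edge` tells which ends are joined by an edge of the diagram.  A circle
without crossings is a cycle of bivalent points.

For a diagram with several connected pieces the position of the pieces relative to each other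
in the plane is not recorded; it has no influence on the link. -/

/-- The ends of edges at the vertices of a diagram. -/
abbrev DiagramEnds (C M : Type) : Type := (C × ZMod 4) ⊕ (M × Bool)

structure LinkDiagram where
  /-- the crossings -/
  Crossing : Type
  /-- the marked ordinary points of the strands -/
  Bivalent : Type
  [fintypeCrossing : Fintype Crossing]
  [decidableEqCrossing : DecidableEq Crossing]
  [fintypeBivalent : Fintype Bivalent]
  [decidableEqBivalent : DecidableEq Bivalent]
  edge : DiagramEnds Crossing Bivalent → DiagramEnds Crossing Bivalent
  edge_edge : ∀ x, edge (edge x) = x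
  edge_ne : ∀ x, edge x ≠ x

namespace LinkDiagram

attribute [instance] fintypeCrossing decidableEqCrossing fintypeBivalent decidableEqBivalent

/-- The ends of edges (darts) of a diagram. -/
abbrev End (D : LinkDiagram) : Type := DiagramEnds D.Crossing D.Bivalent

/-- The next end at the same vertex, counterclockwise. -/
def rot (D : LinkDiagram) : D.End → D.End
  | Sum.inl (c, i) => Sum.inl (c, i + 1)
  | Sum.inr (m, b) => Sum.inr (m, !b)

/-- The next end at the same vertex, clockwise. -/
def rotInv (D : LinkDiagram) : D.End → D.End
  | Sum.inl (c, i) => Sum.inl (c, i - 1)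
  | Sum.inr (m, b) => Sum.inr (m, !b)

/-- The opposite end at the same vertex: a strand which arrives through `x` leaves
through `D.opp x`. -/
def opp (D : LinkDiagram) : D.End → D.End
  | Sum.inl (c, i) => Sum.inl (c, i + 2)
  | Sum.inr (m, b) => Sum.inr (m, !b)

/-- The indices of the two ends of the upper strand at a crossing. -/
def upper (i : ZMod 4) : Bool := decide (i = 1 ∨ i = 3)

/-- The end lies at a crossing, on the upper strand. -/
def IsUpper (D : LinkDiagram) : D.End → Prop
  | Sum.inl (_, i) => upper i = true
  | Sum.inr _ => False

/-! ### Connectedness, faces, planarity -/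

/-- The connected components of the diagram as a graph. -/
def Piece (D : LinkDiagram) : Type := Quot fun x y : D.End => y = D.rot x ∨ y = D.edge x

def Connected (D : LinkDiagram) : Prop := Nat.card D.Piece = 1

/-- The faces: walk along an edge keeping the face on the left, then turn left at the next
vertex.  An end `x` stands for the corner between `x` and `D.rot x`, which belongs to the face
on the left of `x`.  For a connected diagram these are the regions of the complement
(the unbounded one included). -/
def Face (D : LinkDiagram) : Type := Quot fun x y : D.End => y = D.rotInv (D.edge x)

/-- The face on the left of the end `x` (looking away from the vertex). -/
def leftFace (D : LinkDiagram) (x : D.End) : D.Face := Quot.mk _ x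

/-- The diagram can be drawn in the plane (equivalently on the sphere): its Euler characteristic
`V - E + F` is twice the number of its pieces.  Here `V - E` is
`(|C| + |M|) - (2 |C| + |M|) = - |C|`. -/
def IsPlanar (D : LinkDiagram) : Prop :=
  Nat.card D.Face = Fintype.card D.Crossing + 2 * Nat.card D.Piece

/-! ### Alternating diagrams -/

/-- `D.ArcJoins x y`: leaving a vertex through the end `x` and walking along the strand, passing
only through bivalent points, one may arrive at the end `y` of a vertex. -/
inductive ArcJoins (D : LinkDiagram) : D.End → D.End → Prop
  | edge (x : D.End) : ArcJoins D x (D.edge x)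
  | pass (x : D.End) (m : D.Bivalent) (b : Bool) :
      ArcJoins D x (Sum.inr (m, b)) → ArcJoins D x (D.edge (Sum.inr (m, !b)))

/-- Along every strand the over- and undercrossings alternate. -/
def Alternating (D : LinkDiagram) : Prop :=
  ∀ (c d : D.Crossing) (i j : ZMod 4),
    D.ArcJoins (Sum.inl (c, i)) (Sum.inl (d, j)) → upper i ≠ upper j

/-- `S` is the set of black faces of the standard checkerboard shading of an alternating diagram:
faces on the two sides of an edge have different colours, and the black corners of a crossing
are those swept out by the upper strand when it is turned counterclockwise. -/
structure IsStandardShading (D : LinkDiagram) (S : Set D.Face) : Prop where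
  checkerboard : ∀ x : D.End, D.leftFace (D.edge x) ∈ S ↔ D.leftFace x ∉ S
  corner : ∀ (c : D.Crossing) (i : ZMod 4),
    D.leftFace (Sum.inl (c, i)) ∈ S ↔ upper i = true

/-! ### Smoothings and the Kauffman bracket -/

/-- The index of the end to which the end `i` of a crossing is joined by a smoothing.  The positive
marker `true` joins `0, 1` and `2, 3` (it opens a channel between the two corners swept out by
the upper strand turning counterclockwise); the negative marker `false` joins `1, 2` and `3, 0`. -/
def mate (s : Bool) (i : ZMod 4) : ZMod 4 := if upper i = s then i - 1 else i + 1

/-- Smoothing all the crossings by a Kauffman state. -/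
def stateMate (D : LinkDiagram) (s : D.Crossing → Bool) : D.End → D.End
  | Sum.inl (c, i) => Sum.inl (c, mate (s c) i)
  | Sum.inr (m, b) => Sum.inr (m, !b)

/-- The circles of the system `D_s`. -/
def StateCircle (D : LinkDiagram) (s : D.Crossing → Bool) : Type :=
  Quot fun x y : D.End => y = D.stateMate s x ∨ y = D.edge x

/-- The Kauffman bracket in `ℤ[A, A⁻¹]`, where `A = T 1`:
`∑ₛ A ^ σ(s) * (- A ^ 2 - A ^ (-2)) ^ (|D_s| - 1)`. -/
noncomputable def bracket (D : LinkDiagram) : ℤ[T;T⁻¹] :=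
  ∑ s : D.Crossing → Bool,
    LaurentPolynomial.T (∑ c, if s c then (1 : ℤ) else -1) *
      (-LaurentPolynomial.T 2 - LaurentPolynomial.T (-2)) ^ (Nat.card (D.StateCircle s) - 1)

/-- The value of the Kauffman bracket at a nonzero complex number. -/
noncomputable def bracketAt (D : LinkDiagram) (A : ℂˣ) : ℂ :=
  LaurentPolynomial.eval₂ (Int.castRingHom ℂ) A D.bracket

/-- The two ends (second argument) of the two arcs (first argument) which replace
a crossing when it is smoothed. -/
def arcEnd (s : Bool) (a b : Bool) : ZMod 4 :=
  (if a then 2 else 0) + (if b then 1 else 0) + (if s then 0 else 1)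

/-- The arc through the end `i` of a smoothed crossing, and the end of this arc. -/
def arcOf (s : Bool) (i : ZMod 4) : Bool × Bool :=
  let j := i - (if s then 0 else 1)
  (decide (j = 2 ∨ j = 3), decide (j = 1 ∨ j = 3))

theorem arcEnd_arcOf (s : Bool) (i : ZMod 4) : arcEnd s (arcOf s i).1 (arcOf s i).2 = i := by
  revert s i; decide

theorem arcOf_arcEnd (s a b : Bool) : arcOf s (arcEnd s a b) = (a, b) := by
  revert s a b; decide

theorem mate_arcEnd (s a b : Bool) : mate s (arcEnd s a b) = arcEnd s a (!b) := by
  revert s a b; decide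

/-- Smoothing a crossing does not change the set of ends: the four ends at the crossing become
the ends at two new bivalent points, one on each of the two arcs. -/
def smoothEnds (D : LinkDiagram) (p : D.Crossing) (s : Bool) :
    DiagramEnds {c : D.Crossing // c ≠ p} (D.Bivalent ⊕ Bool) ≃ D.End where
  toFun
    | Sum.inl (c, i) => Sum.inl (c.1, i)
    | Sum.inr (Sum.inl m, b) => Sum.inr (m, b)
    | Sum.inr (Sum.inr a, b) => Sum.inl (p, arcEnd s a b)
  invFun
    | Sum.inl (c, i) =>
        if h : c = p then Sum.inr (Sum.inr (arcOf s i).1, (arcOf s i).2) else Sum.inl (⟨c, h⟩, i)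
    | Sum.inr (m, b) => Sum.inr (Sum.inl m, b)
  left_inv := by
    rintro (⟨⟨c, hc⟩, i⟩ | ⟨m | a, b⟩)
    · simp [hc]
    · rfl
    · simp [arcOf_arcEnd]
  right_inv := by
    rintro (⟨c, i⟩ | ⟨m, b⟩)
    · by_cases h : c = p
      · subst h; simp [arcEnd_arcOf]
      · simp [h]
    · rfl

/-- The diagram obtained by smoothing the crossing `p`; `D.smooth p true` is `D^p_0` (the
smoothing with coefficient `A` in the bracket) and `D.smooth p false` is `D^p_∞`. -/
def smooth (D : LinkDiagram) (p : D.Crossing) (s : Bool) : LinkDiagram where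
  Crossing := {c : D.Crossing // c ≠ p}
  Bivalent := D.Bivalent ⊕ Bool
  edge x := (D.smoothEnds p s).symm (D.edge (D.smoothEnds p s x))
  edge_edge x := by simp [D.edge_edge]
  edge_ne x h := D.edge_ne (D.smoothEnds p s x) (by rw [Equiv.symm_apply_eq] at h; exact h)

/-! ### Orientations, the Jones polynomial and the determinant -/

/-- An orientation of the link: `out x` says that the strand leaves the vertex through `x`. -/
structure Orientation (D : LinkDiagram) where
  out : D.End → Bool
  out_edge : ∀ x, out (D.edge x) = !out x
  out_opp : ∀ x, out (D.opp x) = !out x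

theorem opp_opp (D : LinkDiagram) (x : D.End) : D.opp (D.opp x) = x := by
  rcases x with ⟨c, i⟩ | ⟨m, b⟩
  · have : i + 2 + 2 = i := by revert i; decide
    simp [opp, this]
  · simp [opp]

theorem opp_ne (D : LinkDiagram) (x : D.End) : D.opp x ≠ x := by
  rcases x with ⟨c, i⟩ | ⟨m, b⟩
  · have : i + 2 ≠ i := by revert i; decide
    simp [opp, this]
  · simp [opp]

instance (D : LinkDiagram) : Nonempty D.Orientation := by
  classical
  let e : Equiv.Perm D.End := Function.Involutive.toPerm D.edge D.edge_edge
  let o : Equiv.Perm D.End := Function.Involutive.toPerm D.opp D.opp_opp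
  have ee : e * e = 1 := Equiv.ext D.edge_edge
  have oo : o * o = 1 := Equiv.ext D.opp_opp
  let t : Equiv.Perm D.End := o * e
  have e_inv : e⁻¹ = e := inv_eq_of_mul_eq_one_left ee
  have o_inv : o⁻¹ = o := inv_eq_of_mul_eq_one_left oo
  have conj : ∀ k : ℤ, e * t ^ k = t ^ (-k) * e := by
    intro k
    have h1 : e * t * e⁻¹ = t⁻¹ := by
      simp only [t, mul_inv_rev, e_inv, o_inv, mul_assoc, ee, mul_one]
    have h2 : e * t ^ k * e⁻¹ = t ^ (-k) := by rw [← conj_zpow, h1, inv_zpow, zpow_neg]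
    rw [← h2]; simp
  have free : ∀ x, ¬ t.SameCycle x (e x) := by
    rintro x ⟨k, hk⟩
    obtain ⟨j, hj | hj⟩ := Int.even_or_odd' k
    · apply D.edge_ne ((t ^ j) x)
      change (e * t ^ j) x = (t ^ j) x
      rw [conj, Equiv.Perm.mul_apply, ← hk, hj, ← Equiv.Perm.mul_apply, ← zpow_add]
      congr 2; ring
    · apply D.opp_ne ((e * t ^ j) x)
      have h : (t * t ^ j) x = (e * t ^ j) x := by
        rw [conj, Equiv.Perm.mul_apply (t ^ (-j)) e, ← hk, hj, ← Equiv.Perm.mul_apply,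
          ← zpow_add, ← zpow_one_add]
        congr 2; ring
      exact h
  have resp : ∀ x y, t.SameCycle x y → t.SameCycle (e x) (e y) := by
    rintro x y ⟨k, rfl⟩
    refine ⟨-k, ?_⟩
    rw [← Equiv.Perm.mul_apply, ← conj, Equiv.Perm.mul_apply]
  let r : Setoid D.End := Equiv.Perm.SameCycle.setoid t
  let q : D.End → Quotient r := Quotient.mk r
  let E : Quotient r → Quotient r := Quotient.map e (fun x y h => resp x y h)
  let _ : LinearOrder (Quotient r) := linearOrderOfSTO WellOrderingRel
  have hE : ∀ x, q (e x) = E (q x) := fun x => rfl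
  have hEE : ∀ x, E (E (q x)) = q x := fun x => congrArg q (D.edge_edge x)
  have hne : ∀ x, q x ≠ E (q x) := fun x h => free x (Quotient.exact h)
  have flip : ∀ x, decide (E (q x) < E (E (q x))) = !decide (q x < E (q x)) := by
    intro x
    rw [hEE]
    rcases lt_or_gt_of_ne (hne x) with h | h
    · simp [h, h.le]
    · simp [h, h.le]
  refine ⟨⟨fun x => decide (q x < E (q x)), fun x => ?_, fun x => ?_⟩⟩
  · exact flip x
  · have h : q (D.opp x) = q (e x) := by
      refine (Quotient.sound (s := r) ?_).symm
      refine ⟨1, ?_⟩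
      change D.opp (D.edge (D.edge x)) = D.opp x
      rw [D.edge_edge]
    change decide (q (D.opp x) < E (q (D.opp x))) = _
    rw [h]
    exact flip x

/-- The sign of a crossing of an oriented diagram (a crossing is positive if the direction of its
upper strand has to be turned counterclockwise, by less than a half-turn, to become the
direction of its lower strand). -/
def Orientation.sign {D : LinkDiagram} (o : D.Orientation) (c : D.Crossing) : ℤ :=
  if o.out (Sum.inl (c, 0)) = o.out (Sum.inl (c, 1)) then -1 else 1

def Orientation.writhe {D : LinkDiagram} (o : D.Orientation) : ℤ := ∑ c, o.sign c

/-- The value of the Jones polynomial `V(t) = (- A ^ 3) ^ (- w) * ⟨D⟩` at `t = A ^ (-4)`,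
`√t = A ^ (-2)`. -/
noncomputable def jonesAt (D : LinkDiagram) (o : D.Orientation) (A : ℂˣ) : ℂ :=
  (-(A : ℂ) ^ 3) ^ (-o.writhe) * D.bracketAt A

/-- The number `A = exp (- π i / 4)`, so that `A ^ 2 = - i`, i.e. `√t = i` and `t = - 1`. -/
noncomputable def detPoint : ℂˣ :=
  Units.mk0 (Complex.exp (-(Real.pi / 4 : ℝ) * Complex.I)) (Complex.exp_ne_zero _)

/-- The determinant `V(-1)` of an oriented diagram. -/
noncomputable def det (D : LinkDiagram) (o : D.Orientation) : ℂ := D.jonesAt o detPoint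

theorem norm_det (D : LinkDiagram) (o : D.Orientation) :
    ‖D.det o‖ = ‖D.bracketAt detPoint‖ := by
  have h : ‖((detPoint : ℂˣ) : ℂ)‖ = 1 := by
    have := Complex.norm_exp_ofReal_mul_I (-(Real.pi / 4))
    simpa [detPoint] using this
  simp [det, jonesAt, norm_zpow, h]

/-- The absolute value of the determinant of an unoriented diagram, i.e. of the determinant for
any choice of an orientation. -/
noncomputable def absDet (D : LinkDiagram) : ℝ := ‖D.det (Classical.arbitrary D.Orientation)‖

theorem absDet_eq (D : LinkDiagram) (o : D.Orientation) : D.absDet = ‖D.det o‖ := by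
  rw [absDet, norm_det, norm_det]

/-! ### Equivalence of diagrams -/

/-- Orientation-preserving isomorphism of diagrams (isotopy of the sphere). -/
def Isomorphic (D D' : LinkDiagram) : Prop :=
  ∃ f : D.End ≃ D'.End, (∀ x, f (D.rot x) = D'.rot (f x)) ∧
    (∀ x, f (D.edge x) = D'.edge (f x)) ∧ ∀ x, D'.IsUpper (f x) ↔ D.IsUpper x

/-- `D'` arises from `D` by putting one more bivalent point `m` on an edge. -/
def Subdivision (D D' : LinkDiagram) : Prop :=
  ∃ (f : D.End ↪ D'.End) (m : D'.Bivalent) (x : D.End),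
    (∀ y, y ∈ Set.range f ↔ ∀ b, y ≠ Sum.inr (m, b)) ∧
    (∀ y, f (D.rot y) = D'.rot (f y)) ∧
    (∀ y, D'.IsUpper (f y) ↔ D.IsUpper y) ∧
    D'.edge (f x) = Sum.inr (m, false) ∧ D'.edge (f (D.edge x)) = Sum.inr (m, true) ∧
    ∀ y, y ≠ x → y ≠ D.edge x → D'.edge (f y) = f (D.edge y)

/-- First Reidemeister move, `D'` arises from `D` by removing a kink: the ends `i` and `i + 1` of
the crossing `c` are joined by an edge.  Removing the kink amounts to the smoothing of `c` which
does not cut off the kink. -/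
def Reidemeister1 (D D' : LinkDiagram) : Prop :=
  ∃ (c : D.Crossing) (i : ZMod 4) (s : Bool),
    D.edge (Sum.inl (c, i)) = Sum.inl (c, i + 1) ∧ mate s i = i - 1 ∧
    D' = D.smooth c s

/-- Second Reidemeister move, `D'` arises from `D` by removing a bigon: two edges join adjacent
ends `i, i + 1` of `c` to adjacent ends `j + 1, j` of `d`, and one of these two edges is the
upper one at both crossings.  Pulling the two strands apart amounts to smoothing both crossings so
that the bigon is opened on both sides. -/
def Reidemeister2 (D D' : LinkDiagram) : Prop :=
  ∃ (c d : D.Crossing) (hdc : d ≠ c) (i j : ZMod 4) (s s' : Bool),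
    D.edge (Sum.inl (c, i)) = Sum.inl (d, j + 1) ∧
    D.edge (Sum.inl (c, i + 1)) = Sum.inl (d, j) ∧
    upper i = upper (j + 1) ∧
    mate s i = i - 1 ∧ mate s' j = j - 1 ∧
    D' = (D.smooth c s).smooth ⟨d, hdc⟩ s'

/-- The diagram with the edges reattached to the ends by a permutation. -/
def reattach (D : LinkDiagram) (r : Equiv.Perm D.End) : LinkDiagram where
  Crossing := D.Crossing
  Bivalent := D.Bivalent
  edge x := r (D.edge (r.symm x))
  edge_edge x := by simp [D.edge_edge]
  edge_ne x h := D.edge_ne (r.symm x) (by rw [Equiv.eq_symm_apply]; exact h)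

/-- Third Reidemeister move.  The crossings `c 0, c 1, c 2` are the vertices of a triangular face
with sides joining the end `i k + 1` of `c k` to the end `i (k + 1)` of `c (k + 1)`, and
the strand containing the side from `c 0` to `c 1` is the upper one at both crossings.
The move interchanges, on each of the three strands, the two crossings it runs through: what
was attached to the outer end of the strand at `c k` becomes attached to the inner end at
`c (k + 1)`, and vice versa. -/
def Reidemeister3 (D D' : LinkDiagram) : Prop :=
  ∃ (c : ZMod 3 → D.Crossing) (i : ZMod 3 → ZMod 4) (r : Equiv.Perm D.End),
    Function.Injective c ∧
    (∀ k, D.edge (Sum.inl (c k, i k + 1)) = Sum.inl (c (k + 1), i (k + 1))) ∧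
    upper (i 0 + 1) = true ∧ upper (i 1) = true ∧
    (∀ k, r (Sum.inl (c k, i k + 3)) = Sum.inl (c (k + 1), i (k + 1)) ∧
      r (Sum.inl (c (k + 1), i (k + 1))) = Sum.inl (c k, i k + 3) ∧
      r (Sum.inl (c (k + 1), i (k + 1) + 2)) = Sum.inl (c k, i k + 1) ∧
      r (Sum.inl (c k, i k + 1)) = Sum.inl (c (k + 1), i (k + 1) + 2)) ∧
    (∀ d j, d ∉ Set.range c → r (Sum.inl (d, j)) = Sum.inl (d, j)) ∧
    (∀ m b, r (Sum.inr (m, b)) = Sum.inr (m, b)) ∧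
    D' = D.reattach r

/-- An elementary move between planar diagrams. -/
def Move (D D' : LinkDiagram) : Prop :=
  D.IsPlanar ∧ D'.IsPlanar ∧
    (Isomorphic D D' ∨ Subdivision D D' ∨ Reidemeister1 D D' ∨ Reidemeister2 D D' ∨
      Reidemeister3 D D')

/-- The diagrams represent the same link: they are connected by a finite sequence of
moves and inverses of moves. -/
def Equivalent (D D' : LinkDiagram) : Prop := Relation.EqvGen Move D D'

/-! ### Split, alternating and quasi-alternating links

A link is given by any of its planar diagrams; the following properties of planar diagrams are
invariant under `Equivalent`. -/

/-- The link is not split: all its diagrams are connected. -/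
def NonSplitLink (D : LinkDiagram) : Prop := ∀ D', Equivalent D D' → D'.Connected

/-- The link has an alternating diagram. -/
def AlternatingLink (D : LinkDiagram) : Prop := ∃ D', Equivalent D D' ∧ D'.Alternating

/-- The smallest family of links which contains the trivial knot, and contains every link having a
diagram with a crossing `p` such that both smoothings at `p` belong to the family
and `|Det|` is additive at `p`. -/
inductive QuasiAlternating : LinkDiagram → Prop
  | trivialKnot (D : LinkDiagram) :
      D.IsPlanar → IsEmpty D.Crossing → D.Connected → QuasiAlternating D
  | crossing (D : LinkDiagram) (p : D.Crossing) :
      D.IsPlanar → QuasiAlternating (D.smooth p true) → QuasiAlternating (D.smooth p false) →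
      D.absDet = (D.smooth p true).absDet + (D.smooth p false).absDet → QuasiAlternating D
  | isotopy (D D' : LinkDiagram) : Equivalent D D' → QuasiAlternating D → QuasiAlternating D'

end LinkDiagram

/-! ### Counting the classes of a relation -/

/-! The heart of the matter is that, at `A ^ 4 = -1`, the two terms of the skein relation `⟨D⟩ = A
⟨D₀⟩ + A⁻¹ ⟨D_∞⟩` of a connected alternating diagram are nonnegative multiples of the same power of
`A`, so that absolute values add. A disconnected smoothing contributes zero: the loop value `-A ^ 2
- A ^ (-2)` vanishes and every state of such a diagram has at least two circles. If a smoothing is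
connected, Euler's formula makes it lose exactly one face. The positive marker joins two black
corners and leaves the white faces alone, so `B - W` drops by one; the negative marker raises it by
one. The factor `A ^ (±1)` compensates this exactly (`IsShading.bracketAt_smooth`). The induction on
crossings ends with a circle, where `B = W = 1` and the bracket is `1`.

Planarity is a count of faces, so the topology is replaced by permutations. Smoothing composes the
face permutation with a transposition, which changes the number of cycles in a controlled way. This
yields Euler's inequality `card_face_le`, which in turn shows that connected smoothings of connected
planar diagrams are planar.

The shading is obtained by correcting an orientation by one bit on each arc between crossings
(`Alternating.exists_isShading`).

For quasi-alternation, connected planar alternating diagrams are treated by induction. If both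
smoothings at some crossing are connected, additivity of the determinant applies. Otherwise every
crossing is nugatory, and an innermost one is a kink (`exists_kink`), removed by a first
Reidemeister move. Bivalent points are removed beforehand so that the kink is a single edge. -/

theorem Nat.card_quot_congr {α : Type*} {r r' : α → α → Prop}
    (h : ∀ x y, r x y → Quot.mk r' x = Quot.mk r' y)
    (h' : ∀ x y, r' x y → Quot.mk r x = Quot.mk r y) :
    Nat.card (Quot r) = Nat.card (Quot r') := by
  refine Nat.card_congr ⟨Quot.lift (Quot.mk r') h, Quot.lift (Quot.mk r) h', ?_, ?_⟩ <;>
  · rintro ⟨x⟩; rfl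

/-- The relation `r` with one more related pair. -/
def MergeRel {α : Type*} (r : α → α → Prop) (a b x y : α) : Prop := r x y ∨ (x = a ∧ y = b)

theorem Nat.card_quot_mergeRel_of_eq {α : Type*} {r : α → α → Prop} {a b : α}
    (h : Quot.mk r a = Quot.mk r b) :
    Nat.card (Quot (MergeRel r a b)) = Nat.card (Quot r) := by
  refine Nat.card_quot_congr ?_ fun x y h => Quot.sound (Or.inl h)
  rintro x y (hxy | ⟨rfl, rfl⟩)
  · exact Quot.sound hxy
  · exact h

theorem Nat.card_quot_mergeRel_of_ne {α : Type*} [Finite α] {r : α → α → Prop} {a b : α}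
    (h : Quot.mk r a ≠ Quot.mk r b) :
    Nat.card (Quot (MergeRel r a b)) + 1 = Nat.card (Quot r) := by
  classical
  let e : Quot (MergeRel r a b) ≃ {q : Quot r // q ≠ Quot.mk r b} :=
    { toFun := Quot.lift
        (fun x => if hx : Quot.mk r x = Quot.mk r b then ⟨Quot.mk r a, h⟩ else ⟨Quot.mk r x, hx⟩) (by
          rintro x y (hxy | ⟨rfl, rfl⟩)
          · have : Quot.mk r x = Quot.mk r y := Quot.sound hxy
            simp only [this]
          · simp [h])
      invFun := fun q => Quot.lift (Quot.mk (MergeRel r a b))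
        (fun x y hxy => Quot.sound (Or.inl hxy)) q.1
      left_inv := by
        rintro ⟨x⟩
        change Quot.lift _ _ (Subtype.val (dite _ _ _)) = Quot.mk _ x
        split_ifs with hx
        · have h1 : Quot.mk (MergeRel r a b) x = Quot.mk (MergeRel r a b) b :=
            congrArg (Quot.lift (Quot.mk (MergeRel r a b))
              (fun x y hxy => Quot.sound (Or.inl hxy))) hx
          rw [h1]
          exact Quot.sound (Or.inr ⟨rfl, rfl⟩)
        · rfl
      right_inv := by
        rintro ⟨⟨x⟩, hx⟩
        exact dif_neg hx }
  rw [Nat.card_congr e]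
  have := Finite.card_option (α := {q : Quot r // q ≠ Quot.mk r b})
  rw [← this]
  exact Nat.card_congr (Equiv.optionSubtypeNe _)

theorem Nat.card_quot_le_card_quot_mergeRel {α : Type*} [Finite α] (r : α → α → Prop) (a b : α) :
    Nat.card (Quot r) ≤ Nat.card (Quot (MergeRel r a b)) + 1 := by
  by_cases h : Quot.mk r a = Quot.mk r b
  · rw [Nat.card_quot_mergeRel_of_eq h]; omega
  · rw [Nat.card_quot_mergeRel_of_ne h]

theorem Nat.card_quot_mergeRel_le {α : Type*} [Finite α] (r : α → α → Prop) (a b : α) :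
    Nat.card (Quot (MergeRel r a b)) ≤ Nat.card (Quot r) := by
  by_cases h : Quot.mk r a = Quot.mk r b
  · rw [Nat.card_quot_mergeRel_of_eq h]
  · rw [← Nat.card_quot_mergeRel_of_ne h]; omega

/-! ### Cycles of a map composed with a transposition. -/

/-- The relation whose classes are the cycles of `f`. -/
abbrev StepRel {α : Type*} (f : α → α) (x y : α) : Prop := y = f x

theorem quot_stepRel_mk {α : Type*} (f : α → α) (x : α) :
    Quot.mk (StepRel f) (f x) = Quot.mk (StepRel f) x := by
  symm; exact Quot.sound rfl

/-- Once `a` and `b` are identified, the transposition is invisible. Both cycle counts can therefore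
be compared with one common quotient. -/
theorem card_quot_mergeRel_swap {α : Type*} [DecidableEq α] (f : α → α) (a b : α) :
    Nat.card (Quot (MergeRel (StepRel fun x => Equiv.swap a b (f x)) a b)) =
      Nat.card (Quot (MergeRel (StepRel f) a b)) := by
  have key : ∀ g : α → α, ∀ x, Quot.mk (MergeRel (StepRel g) a b) x =
      Quot.mk (MergeRel (StepRel g) a b) (Equiv.swap a b (g x)) := by
    intro g x
    have h1 : Quot.mk (MergeRel (StepRel g) a b) x = Quot.mk _ (g x) := Quot.sound (Or.inl rfl)
    have h2 : Quot.mk (MergeRel (StepRel g) a b) a = Quot.mk _ b := Quot.sound (Or.inr ⟨rfl, rfl⟩)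
    rw [h1]
    rcases eq_or_ne (g x) a with h | h
    · rw [h, Equiv.swap_apply_left, h2]
    · rcases eq_or_ne (g x) b with h' | h'
      · rw [h', Equiv.swap_apply_right, h2]
      · rw [Equiv.swap_apply_of_ne_of_ne h h']
  apply Nat.card_quot_congr
  · rintro x y (rfl | ⟨rfl, rfl⟩)
    · exact key f x
    · exact Quot.sound (Or.inr ⟨rfl, rfl⟩)
  · rintro x y (rfl | ⟨rfl, rfl⟩)
    · have := key (fun x => Equiv.swap a b (f x)) x
      simpa using this
    · exact Quot.sound (Or.inr ⟨rfl, rfl⟩)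

/-- Composition with a transposition removes at most one cycle. -/
theorem card_cycles_le_card_cycles_swap {α : Type*} [Finite α] [DecidableEq α] (f : α → α)
    (a b : α) :
    Nat.card (Quot (StepRel f)) ≤
      Nat.card (Quot (StepRel fun x => Equiv.swap a b (f x))) + 1 := by
  have h1 := Nat.card_quot_le_card_quot_mergeRel (StepRel f) a b
  have h2 := Nat.card_quot_mergeRel_le (StepRel fun x => Equiv.swap a b (f x)) a b
  rw [card_quot_mergeRel_swap] at h2
  omega

/-- If `a` and `b` lie on different cycles of `swap a b * f`, then they lie on the same cycle
of `f`. -/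
theorem mk_eq_mk_of_swap_ne {α : Type*} [Finite α] [DecidableEq α] (f : Equiv.Perm α) (a b : α)
    (h : Quot.mk (StepRel fun x => Equiv.swap a b (f x)) a ≠
      Quot.mk (StepRel fun x => Equiv.swap a b (f x)) b) :
    Quot.mk (StepRel f) a = Quot.mk (StepRel f) b := by
  by_contra hab
  let g : Equiv.Perm α := Equiv.swap a b * f
  have hg : ∀ n : ℕ, Quot.mk (StepRel fun x => Equiv.swap a b (f x)) ((g ^ n) a) = Quot.mk _ a := by
    intro n
    induction n with
    | zero => rfl
    | succ n ih => rw [pow_succ', Equiv.Perm.mul_apply, ← ih]; exact quot_stepRel_mk _ _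
  -- The `g`-orbit of `a` stays in the `f`-cycle of `a`: a step on which `f` and `g` differ would
  -- reach `b`, either under `g` (against `h`) or under `f` (against `hab`).
  have hf : ∀ n : ℕ, Quot.mk (StepRel f) ((g ^ n) a) = Quot.mk _ a := by
    intro n
    induction n with
    | zero => rfl
    | succ n ih =>
      have hs := hg (n + 1)
      rw [pow_succ', Equiv.Perm.mul_apply] at hs ⊢
      rcases eq_or_ne (f ((g ^ n) a)) a with h1 | h1
      · rw [show g ((g ^ n) a) = b by simp [g, h1]] at hs
        exact absurd hs.symm h
      · rcases eq_or_ne (f ((g ^ n) a)) b with h2 | h2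
        · exact absurd (by rw [← ih, ← h2, quot_stepRel_mk]) hab
        · rw [show g ((g ^ n) a) = f ((g ^ n) a) by
            simp [g, Equiv.swap_apply_of_ne_of_ne h1 h2], quot_stepRel_mk, ih]
  -- The orbit returns to `a`, and the last step of `g` into `a` is a step of `f` into `b`.
  obtain ⟨n, hn, hn'⟩ := (isOfFinOrder_of_finite g).exists_pow_eq_one
  obtain ⟨m, rfl⟩ := Nat.exists_eq_succ_of_ne_zero hn.ne'
  have h1 : g ((g ^ m) a) = a := by
    rw [← Equiv.Perm.mul_apply, ← pow_succ', hn']; rfl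
  have h2 : f ((g ^ m) a) = b := by
    have := congrArg (Equiv.swap a b) h1
    simpa [g] using this
  exact hab (by rw [← hf m, ← h2, quot_stepRel_mk])

/-- Merging `a` and `b` costs nothing for `f`, where they already share a cycle, and costs one class
for the composite. -/
theorem card_cycles_swap_of_ne {α : Type*} [Finite α] [DecidableEq α] (f : Equiv.Perm α) (a b : α)
    (h : Quot.mk (StepRel fun x => Equiv.swap a b (f x)) a ≠
      Quot.mk (StepRel fun x => Equiv.swap a b (f x)) b) :
    Nat.card (Quot (StepRel f)) + 1 = Nat.card (Quot (StepRel fun x => Equiv.swap a b (f x))) := by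
  rw [← Nat.card_quot_mergeRel_of_eq (mk_eq_mk_of_swap_ne f a b h),
    ← Nat.card_quot_mergeRel_of_ne h, card_quot_mergeRel_swap]

namespace LinkDiagram

variable (D : LinkDiagram)

/-! ### The ends of a smoothed diagram -/

theorem rotInv_rot (x : D.End) : D.rotInv (D.rot x) = x := by
  rcases x with ⟨c, i⟩ | ⟨m, b⟩ <;> simp [rot, rotInv]

theorem rot_rotInv (x : D.End) : D.rot (D.rotInv x) = x := by
  rcases x with ⟨c, i⟩ | ⟨m, b⟩ <;> simp [rot, rotInv]

/-- The permutation whose cycles are the faces. -/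
def facePerm : Equiv.Perm D.End where
  toFun x := D.rotInv (D.edge x)
  invFun x := D.edge (D.rot x)
  left_inv x := by simp [rot_rotInv, D.edge_edge]
  right_inv x := by simp [rotInv_rot, D.edge_edge]

/-- The map `rot` of the diagram with `p` smoothed, on the ends of `D`. -/
def smoothRot (p : D.Crossing) (s : Bool) : D.End → D.End
  | Sum.inl (c, i) => if c = p then Sum.inl (c, mate s i) else Sum.inl (c, i + 1)
  | Sum.inr (m, b) => Sum.inr (m, !b)

/-- The map `rotInv` of the diagram with `p` smoothed, on the ends of `D`. -/
def smoothRotInv (p : D.Crossing) (s : Bool) : D.End → D.End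
  | Sum.inl (c, i) => if c = p then Sum.inl (c, mate s i) else Sum.inl (c, i - 1)
  | Sum.inr (m, b) => Sum.inr (m, !b)

/-- The ends of the diagram with `p` smoothed are the ends of `D`. -/
def smoothEquiv (p : D.Crossing) (s : Bool) : (D.smooth p s).End ≃ D.End := D.smoothEnds p s

theorem smoothEquiv_rot (p : D.Crossing) (s : Bool) (x : (D.smooth p s).End) :
    D.smoothEquiv p s ((D.smooth p s).rot x) = D.smoothRot p s (D.smoothEquiv p s x) := by
  rcases x with ⟨c, i⟩ | ⟨m | a, b⟩
  · exact (if_neg c.2).symm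
  · rfl
  · change Sum.inl (p, arcEnd s a (!b)) =
      if p = p then (Sum.inl (p, mate s (arcEnd s a b)) : D.End) else _
    rw [if_pos rfl, mate_arcEnd]

theorem smoothEquiv_rotInv (p : D.Crossing) (s : Bool) (x : (D.smooth p s).End) :
    D.smoothEquiv p s ((D.smooth p s).rotInv x) = D.smoothRotInv p s (D.smoothEquiv p s x) := by
  rcases x with ⟨c, i⟩ | ⟨m | a, b⟩
  · exact (if_neg c.2).symm
  · rfl
  · change Sum.inl (p, arcEnd s a (!b)) =
      if p = p then (Sum.inl (p, mate s (arcEnd s a b)) : D.End) else _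
    rw [if_pos rfl, mate_arcEnd]

theorem smoothEquiv_edge (p : D.Crossing) (s : Bool) (x : (D.smooth p s).End) :
    D.smoothEquiv p s ((D.smooth p s).edge x) = D.edge (D.smoothEquiv p s x) :=
  (D.smoothEnds p s).apply_symm_apply _

/-- The relation whose classes are the pieces of the diagram with `p` smoothed. -/
def smoothRel (p : D.Crossing) (s : Bool) (x y : D.End) : Prop :=
  y = D.smoothRot p s x ∨ y = D.edge x

theorem card_piece_smooth (p : D.Crossing) (s : Bool) :
    Nat.card (D.smooth p s).Piece = Nat.card (Quot (D.smoothRel p s)) := by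
  refine Nat.card_congr (Quot.congr (D.smoothEquiv p s) fun x y => ?_)
  rw [smoothRel, ← smoothEquiv_rot, ← smoothEquiv_edge, EmbeddingLike.apply_eq_iff_eq,
    EmbeddingLike.apply_eq_iff_eq]

/-! ### The effect of a smoothing on the face permutation. -/

/-- One of the two corners at `p` which are joined by the smoothing with marker `s`; the other
one is `D.cornerB p s`. -/
def cornerA (p : D.Crossing) (s : Bool) : D.End := Sum.inl (p, if s then 1 else 0)

/-- See `cornerA`. -/
def cornerB (p : D.Crossing) (s : Bool) : D.End := Sum.inl (p, if s then 3 else 2)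

/-- This is what brings faces under the transposition lemmas: opening a channel between two corners
is composition with their transposition. -/
theorem smoothRotInv_eq_swap (p : D.Crossing) (s : Bool) (x : D.End) :
    D.smoothRotInv p s x = Equiv.swap (D.cornerA p s) (D.cornerB p s) (D.rotInv x) := by
  rcases x with ⟨c, i⟩ | ⟨m, b⟩
  · by_cases h : c = p
    · subst h
      have key : ∀ (s : Bool) (i : ZMod 4), mate s i =
          Equiv.swap (if s then 1 else 0) (if s then 3 else 2) (i - 1) := by decide
      have inj : Function.Injective fun j : ZMod 4 => (Sum.inl (c, j) : D.End) := by
        intro j j' h; simpa using h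
      simp only [smoothRotInv, if_true, key, cornerA, cornerB, rotInv]
      exact inj.map_swap _ _ _
    · rw [Equiv.swap_apply_of_ne_of_ne] <;> simp [smoothRotInv, rotInv, cornerA, cornerB, h]
  · rw [Equiv.swap_apply_of_ne_of_ne] <;> simp [smoothRotInv, rotInv, cornerA, cornerB]

/-- The permutation whose cycles are the faces of the diagram with `p` smoothed, on the
ends of `D`. -/
abbrev smoothFaceMap (p : D.Crossing) (s : Bool) (x : D.End) : D.End :=
  Equiv.swap (D.cornerA p s) (D.cornerB p s) (D.facePerm x)

/-- The faces of the diagram with `p` smoothed, in terms of the ends of `D`. -/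
def smoothFaceEquiv (p : D.Crossing) (s : Bool) :
    (D.smooth p s).Face ≃ Quot (StepRel (D.smoothFaceMap p s)) :=
  Quot.congr (D.smoothEquiv p s) fun x y => by
    change _ ↔ _ = Equiv.swap _ _ (D.rotInv (D.edge _))
    rw [← smoothRotInv_eq_swap, ← smoothEquiv_edge, ← smoothEquiv_rotInv,
      EmbeddingLike.apply_eq_iff_eq]

instance : Finite D.Piece := inferInstanceAs (Finite (Quot _))

instance : Finite D.Face := inferInstanceAs (Finite (Quot _))

/-! ### Pieces of a smoothed diagram -/

variable {D}

theorem smoothRel_mk_edge (p : D.Crossing) (s : Bool) (x : D.End) :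
    Quot.mk (D.smoothRel p s) (D.edge x) = Quot.mk _ x := by
  symm; exact Quot.sound (Or.inr rfl)

theorem smoothRel_mk_smoothRot (p : D.Crossing) (s : Bool) (x : D.End) :
    Quot.mk (D.smoothRel p s) (D.smoothRot p s x) = Quot.mk _ x := by
  symm; exact Quot.sound (Or.inl rfl)

theorem smoothRel_mk_mate (p : D.Crossing) (s : Bool) (i : ZMod 4) :
    Quot.mk (D.smoothRel p s) (Sum.inl (p, mate s i)) = Quot.mk _ (Sum.inl (p, i)) := by
  rw [← smoothRel_mk_smoothRot p s (Sum.inl (p, i))]; simp [smoothRot]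

theorem smoothRel_mk_add_one {p c : D.Crossing} (s : Bool) (h : c ≠ p) (i : ZMod 4) :
    Quot.mk (D.smoothRel p s) (Sum.inl (c, i + 1)) = Quot.mk _ (Sum.inl (c, i)) := by
  rw [← smoothRel_mk_smoothRot p s (Sum.inl (c, i))]; simp [smoothRot, h]

theorem mk_eq_mk_of_add_one {β : Type*} (f : ZMod 4 → β) (h : ∀ i, f (i + 1) = f i) (i j : ZMod 4) :
    f i = f j := by
  have key : ∀ i, f i = f 0 := by
    intro i
    fin_cases i
    · rfl
    · exact h 0
    · exact (h 1).trans (h 0)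
    · exact (h 2).trans ((h 1).trans (h 0))
  rw [key i, key j]

theorem smoothRel_mk_crossing {p c : D.Crossing} (s : Bool) (h : c ≠ p) (i j : ZMod 4) :
    Quot.mk (D.smoothRel p s) (Sum.inl (c, i)) = Quot.mk _ (Sum.inl (c, j)) :=
  mk_eq_mk_of_add_one (fun i => Quot.mk (D.smoothRel p s) (Sum.inl (c, i)))
    (smoothRel_mk_add_one s h) i j

theorem piece_mk_edge (x : D.End) : (Quot.mk _ (D.edge x) : D.Piece) = Quot.mk _ x :=
  by
  symm; exact Quot.sound (Or.inr rfl)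

theorem piece_mk_rot (x : D.End) : (Quot.mk _ (D.rot x) : D.Piece) = Quot.mk _ x :=
  by
  symm; exact Quot.sound (Or.inl rfl)

theorem piece_mk_crossing (c : D.Crossing) (i j : ZMod 4) :
    (Quot.mk _ (Sum.inl (c, i)) : D.Piece) = Quot.mk _ (Sum.inl (c, j)) :=
  mk_eq_mk_of_add_one (fun i => (Quot.mk _ (Sum.inl (c, i)) : D.Piece))
    (fun i => piece_mk_rot (Sum.inl (c, i))) i j

/-- After the smoothing of `p`, every end at `p` is in the piece of one of the two ends
`cornerA` and `cornerB`. -/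
theorem smoothRel_mk_or (p : D.Crossing) (s : Bool) (i : ZMod 4) :
    Quot.mk (D.smoothRel p s) (Sum.inl (p, i)) = Quot.mk _ (D.cornerA p s) ∨
      Quot.mk (D.smoothRel p s) (Sum.inl (p, i)) = Quot.mk _ (D.cornerB p s) := by
  have key : ∀ (s : Bool) (i : ZMod 4), i = (if s then 1 else 0) ∨ i = (if s then 3 else 2) ∨
      i = mate s (if s then 1 else 0) ∨ i = mate s (if s then 3 else 2) := by decide
  rcases key s i with h | h | h | h
  · left; rw [h]; rfl
  · right; rw [h]; rfl
  · left; rw [h, smoothRel_mk_mate]; rfl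
  · right; rw [h, smoothRel_mk_mate]; rfl

/-- The ends `cornerA` and `cornerB` lie on different arcs of the smoothing, so identifying them
glues the two arcs back to one vertex. Smoothing therefore adds at most one piece. -/
theorem card_quot_mergeRel_smoothRel (p : D.Crossing) (s : Bool) :
    Nat.card (Quot (MergeRel (D.smoothRel p s) (D.cornerA p s) (D.cornerB p s))) =
      Nat.card D.Piece := by
  have lift : ∀ x y, Quot.mk (D.smoothRel p s) x = Quot.mk (D.smoothRel p s) y →
      Quot.mk (MergeRel (D.smoothRel p s) (D.cornerA p s) (D.cornerB p s)) x = Quot.mk _ y :=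
    fun x y h => congrArg (Quot.lift (Quot.mk _) fun x y hxy => Quot.sound (Or.inl hxy)) h
  have hab : Quot.mk (MergeRel (D.smoothRel p s) (D.cornerA p s) (D.cornerB p s))
      (D.cornerA p s) = Quot.mk _ (D.cornerB p s) := Quot.sound (Or.inr ⟨rfl, rfl⟩)
  apply Nat.card_quot_congr
  · rintro x y ((rfl | rfl) | ⟨rfl, rfl⟩)
    · rcases x with ⟨c, i⟩ | ⟨m, b⟩
      · simp only [smoothRot]
        split_ifs <;> exact piece_mk_crossing _ _ _
      · exact (piece_mk_rot _).symm
    · exact (piece_mk_edge x).symm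
    · exact piece_mk_crossing _ _ _
  · rintro x y (rfl | rfl)
    · rcases x with ⟨c, i⟩ | ⟨m, b⟩
      · by_cases h : c = p
        · subst h
          have key : ∀ i, Quot.mk (MergeRel (D.smoothRel c s) (D.cornerA c s) (D.cornerB c s))
              (Sum.inl (c, i)) = Quot.mk _ (D.cornerA c s) := fun i => by
            rcases smoothRel_mk_or c s i with h | h
            · exact lift _ _ h
            · exact (lift _ _ h).trans hab.symm
          exact (key i).trans (key (i + 1)).symm
        · exact lift _ _ (smoothRel_mk_add_one s h i).symm
      · exact lift _ _ (smoothRel_mk_smoothRot p s (Sum.inr (m, b))).symm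
    · exact lift _ _ (smoothRel_mk_edge p s x).symm

theorem card_piece_smooth_of_eq {p : D.Crossing} {s : Bool}
    (h : Quot.mk (D.smoothRel p s) (D.cornerA p s) = Quot.mk _ (D.cornerB p s)) :
    Nat.card (D.smooth p s).Piece = Nat.card D.Piece := by
  rw [card_piece_smooth, ← Nat.card_quot_mergeRel_of_eq h, card_quot_mergeRel_smoothRel]

theorem card_piece_smooth_of_ne {p : D.Crossing} {s : Bool}
    (h : Quot.mk (D.smoothRel p s) (D.cornerA p s) ≠ Quot.mk _ (D.cornerB p s)) :
    Nat.card (D.smooth p s).Piece = Nat.card D.Piece + 1 := by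
  rw [card_piece_smooth, ← Nat.card_quot_mergeRel_of_ne h, card_quot_mergeRel_smoothRel]

theorem card_piece_le_card_piece_smooth (p : D.Crossing) (s : Bool) :
    Nat.card D.Piece ≤ Nat.card (D.smooth p s).Piece := by
  by_cases h : Quot.mk (D.smoothRel p s) (D.cornerA p s) = Quot.mk _ (D.cornerB p s)
  · rw [card_piece_smooth_of_eq h]
  · rw [card_piece_smooth_of_ne h]; omega

theorem card_face_le_card_face_smooth (p : D.Crossing) (s : Bool) :
    Nat.card D.Face ≤ Nat.card (D.smooth p s).Face + 1 := by
  rw [Nat.card_congr (D.smoothFaceEquiv p s)]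
  exact card_cycles_le_card_cycles_swap D.facePerm _ _

theorem card_crossing_smooth (p : D.Crossing) (s : Bool) :
    Fintype.card (D.smooth p s).Crossing + 1 = Fintype.card D.Crossing := by
  have h : Fintype.card (D.smooth p s).Crossing = Fintype.card {c : D.Crossing // c ≠ p} :=
    Fintype.card_congr (Equiv.refl _)
  have := Fintype.card_pos_iff.2 ⟨p⟩
  rw [h, Fintype.card_subtype_compl, Fintype.card_subtype_eq]
  omega

/-- Each face lies in a single piece, so corners in different pieces are in different faces after
smoothing; hence the transposition has split a cycle. -/
theorem card_face_smooth_of_ne {p : D.Crossing} {s : Bool}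
    (h : Quot.mk (D.smoothRel p s) (D.cornerA p s) ≠ Quot.mk _ (D.cornerB p s)) :
    Nat.card D.Face + 1 = Nat.card (D.smooth p s).Face := by
  rw [Nat.card_congr (D.smoothFaceEquiv p s)]
  refine card_cycles_swap_of_ne D.facePerm _ _ fun h' => h ?_
  refine congrArg (Quot.lift (Quot.mk (D.smoothRel p s)) ?_) h'
  rintro x y rfl
  change Quot.mk _ x = Quot.mk _ (Equiv.swap _ _ (D.rotInv (D.edge x)))
  rw [← smoothRotInv_eq_swap, ← smoothRel_mk_edge p s x]
  generalize D.edge x = y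
  rcases y with ⟨c, i⟩ | ⟨m, b⟩
  · by_cases hc : c = p
    · subst hc
      simp only [smoothRotInv, if_true]
      exact (smoothRel_mk_mate c s i).symm
    · simp only [smoothRotInv, if_neg hc]
      exact smoothRel_mk_crossing s hc _ _
  · exact (smoothRel_mk_smoothRot p s (Sum.inr (m, b))).symm

/-! ### Euler's inequality -/

theorem leftFace_rotInv_edge (x : D.End) : D.leftFace (D.rotInv (D.edge x)) = D.leftFace x :=
  by
  symm; exact Quot.sound rfl

theorem card_face_le_of_isEmpty_crossing [IsEmpty D.Crossing] :
    Nat.card D.Face ≤ 2 * Nat.card D.Piece := by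
  have hrot : ∀ x : D.End, D.rotInv x = D.rot x := by
    rintro (⟨c, i⟩ | ⟨m, b⟩)
    · exact isEmptyElim c
    · rfl
  -- A circle has the faces of `x` and `D.edge x` on its sides. Both `rot` and `edge` exchange the
  -- two, whence the unordered pair.
  let u : D.Piece → Sym2 D.Face := Quot.lift (fun x => s(D.leftFace x, D.leftFace (D.edge x))) (by
    rintro x y (rfl | rfl)
    · have h1 := leftFace_rotInv_edge (D.edge x)
      have h2 := leftFace_rotInv_edge (D.edge (D.rot x))
      rw [D.edge_edge, hrot] at h1
      rw [D.edge_edge, rotInv_rot] at h2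
      rw [h1, h2, Sym2.eq_swap]
    · rw [D.edge_edge, Sym2.eq_swap])
  let v : D.Piece × Bool → D.Face := fun q =>
    if q.2 then D.leftFace q.1.out else D.leftFace (D.edge q.1.out)
  have hv : Function.Surjective v := by
    rintro ⟨x⟩
    have h : u (Quot.mk _ x) = u (Quot.mk _ (Quot.out (Quot.mk _ x : D.Piece))) := by
      rw [Quot.out_eq]
    have h' : D.leftFace x ∈ u (Quot.mk _ x) := Sym2.mem_mk_left _ _
    rw [h] at h'
    rcases Sym2.mem_iff.1 h' with h' | h'
    · exact ⟨(Quot.mk _ x, true), h'.symm⟩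
    · exact ⟨(Quot.mk _ x, false), h'.symm⟩
  have := Nat.card_le_card_of_surjective v hv
  rwa [Nat.card_prod, Nat.card_eq_fintype_card (α := Bool), Fintype.card_bool, mul_comm] at this

/-- Euler's inequality: the genus of a diagram is nonnegative. -/
theorem card_face_le (D : LinkDiagram) :
    Nat.card D.Face ≤ Fintype.card D.Crossing + 2 * Nat.card D.Piece := by
  induction hn : Fintype.card D.Crossing generalizing D with
  | zero =>
    have := Fintype.card_eq_zero_iff.1 hn
    simpa using card_face_le_of_isEmpty_crossing (D := D)
  | succ n ih =>
    obtain ⟨p⟩ : Nonempty D.Crossing := Fintype.card_pos_iff.1 (by omega)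
    have hC := card_crossing_smooth p true
    have := ih (D.smooth p true) (by omega)
    -- Losing the crossing pays for the loss of at most one face. If a piece splits off, one face is
    -- gained, and the two units of slack for the new piece are used up by this face and the lost
    -- crossing.
    by_cases h : Quot.mk (D.smoothRel p true) (D.cornerA p true) = Quot.mk _ (D.cornerB p true)
    · have h1 := card_piece_smooth_of_eq h
      have h2 := card_face_le_card_face_smooth p true
      omega
    · have h1 := card_piece_smooth_of_ne h
      have h2 := card_face_smooth_of_ne h
      omega

end LinkDiagram

namespace LinkDiagram

variable {D : LinkDiagram}

/-! ### Shadings as functions on corners -/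

/-- A standard shading, as a function on corners (`true` means black). -/
structure IsShading (D : LinkDiagram) (k : D.End → Bool) : Prop where
  edge : ∀ x, k (D.edge x) = !k x
  rot : ∀ x, k (D.rot x) = !k x
  crossing : ∀ c i, k (Sum.inl (c, i)) = upper i

theorem upper_add_one (i : ZMod 4) : upper (i + 1) = !upper i := by revert i; decide

theorem upper_mate (s : Bool) (i : ZMod 4) : upper (mate s i) = !upper i := by
  revert s i; decide

namespace IsShading

variable {k : D.End → Bool}

theorem rotInv (h : D.IsShading k) (x : D.End) : k (D.rotInv x) = !k x := by
  have := h.rot (D.rotInv x)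
  rw [rot_rotInv] at this
  rw [this, Bool.not_not]

theorem facePerm (h : D.IsShading k) (x : D.End) : k (D.facePerm x) = k x := by
  change k (D.rotInv (D.edge x)) = k x
  rw [h.rotInv, h.edge, Bool.not_not]

theorem arcJoins (h : D.IsShading k) {x y : D.End} (hxy : D.ArcJoins x y) : k y = !k x := by
  induction hxy with
  | edge => exact h.edge _
  | pass m b _ ih =>
    have : k (Sum.inr (m, !b)) = !k (Sum.inr (m, b)) := h.rot (Sum.inr (m, b))
    rw [h.edge, this, ih, Bool.not_not]

theorem alternating (h : D.IsShading k) : D.Alternating := by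
  intro c d i j hij heq
  have := h.arcJoins hij
  rw [h.crossing, h.crossing, heq] at this
  simp at this

/-- Both smoothings join an upper end to a lower one, so the colours still alternate at the new
bivalent points. -/
theorem smooth (h : D.IsShading k) (p : D.Crossing) (s : Bool) :
    (D.smooth p s).IsShading (k ∘ D.smoothEquiv p s) where
  edge x := by simp only [Function.comp, smoothEquiv_edge, h.edge]
  rot x := by
    simp only [Function.comp, smoothEquiv_rot]
    generalize D.smoothEquiv p s x = y
    rcases y with ⟨c, i⟩ | ⟨m, b⟩
    · simp only [smoothRot]
      split_ifs <;> simp only [h.crossing, upper_mate, upper_add_one]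
    · exact h.rot (Sum.inr (m, b))
  crossing c i := h.crossing c.1 i

end IsShading

/-- The faces of a given colour. -/
def facesOf (D : LinkDiagram) (k : D.End → Bool) (c : Bool) : Set D.Face :=
  D.leftFace '' {x | k x = c}

namespace IsShading

variable {k : D.End → Bool}

theorem mem_facesOf (h : D.IsShading k) (c : Bool) (x : D.End) :
    D.leftFace x ∈ D.facesOf k c ↔ k x = c := by
  refine ⟨?_, fun hx => ⟨x, hx, rfl⟩⟩
  rintro ⟨y, hy, hyx⟩
  have := congrArg (Quot.lift k (by rintro x y rfl; exact (h.facePerm x).symm)) hyx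
  exact this.symm.trans hy

theorem compl_facesOf (h : D.IsShading k) : (D.facesOf k true)ᶜ = D.facesOf k false := by
  ext ⟨x⟩
  change ¬ D.leftFace x ∈ D.facesOf k true ↔ D.leftFace x ∈ D.facesOf k false
  rw [h.mem_facesOf, h.mem_facesOf, Bool.not_eq_true]

theorem ncard_facesOf_add (h : D.IsShading k) :
    (D.facesOf k true).ncard + (D.facesOf k false).ncard = Nat.card D.Face := by
  rw [← h.compl_facesOf, Set.ncard_add_ncard_compl]

theorem isStandardShading (h : D.IsShading k) : D.IsStandardShading (D.facesOf k true) where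
  checkerboard x := by simp [h.mem_facesOf, h.edge]
  corner c i := by rw [h.mem_facesOf, h.crossing]

end IsShading

theorem IsStandardShading.exists_isShading {S : Set D.Face} (h : D.IsStandardShading S) :
    ∃ k, D.IsShading k ∧ D.facesOf k true = S := by
  classical
  have hk : D.IsShading fun x => decide (D.leftFace x ∈ S) :=
    { edge := fun x => by simp [h.checkerboard]
      rot := fun x => by
        have h1 := leftFace_rotInv_edge (D.edge (D.rot x))
        rw [D.edge_edge, rotInv_rot] at h1
        have h2 := h.checkerboard (D.rot x)
        rw [← h1] at h2
        simp [h2]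
      crossing := fun c i => by simp [h.corner] }
  refine ⟨_, hk, ?_⟩
  ext ⟨x⟩
  change D.leftFace x ∈ _ ↔ D.leftFace x ∈ S
  rw [hk.mem_facesOf, decide_eq_true_iff]

/-! ### Existence of the standard shading -/

/-- The relation whose classes are the arcs between crossings. -/
def arcRel (D : LinkDiagram) (x y : D.End) : Prop :=
  y = D.edge x ∨ ∃ m b, x = Sum.inr (m, b) ∧ y = Sum.inr (m, !b)

theorem arcRel_symm {x y : D.End} (h : D.arcRel x y) : D.arcRel y x := by
  rcases h with rfl | ⟨m, b, rfl, rfl⟩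
  · left; rw [D.edge_edge]
  · right; exact ⟨m, !b, rfl, by rw [Bool.not_not]⟩

theorem edge_injective : Function.Injective D.edge :=
  Function.LeftInverse.injective D.edge_edge

/-- `R` collects the start and the ends through which the walk from `(c, i)` enters or leaves a
vertex; this set is closed under `arcRel`. -/
theorem arcJoins_of_arcRel {c d : D.Crossing} {i j : ZMod 4}
    (h : Quot.mk D.arcRel (Sum.inl (c, i)) = Quot.mk _ (Sum.inl (d, j))) :
    (Sum.inl (d, j) : D.End) = Sum.inl (c, i) ∨ D.ArcJoins (Sum.inl (c, i)) (Sum.inl (d, j)) := by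
  let R : D.End → Prop := fun y => y = Sum.inl (c, i) ∨ D.ArcJoins (Sum.inl (c, i)) y ∨
    D.ArcJoins (Sum.inl (c, i)) (D.edge y)
  have hR : ∀ x y, D.arcRel x y → R x → R y := by
    rintro x y (rfl | ⟨m, b, rfl, rfl⟩) hx
    · rcases hx with rfl | hx | hx
      · exact Or.inr (Or.inl (.edge _))
      · exact Or.inr (Or.inr (by rwa [D.edge_edge]))
      · exact Or.inr (Or.inl hx)
    · rcases hx with hx | hx | hx
      · cases hx
      · exact Or.inr (Or.inr (.pass _ m b hx))
      · generalize hz : D.edge (Sum.inr (m, b)) = z at hx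
        cases hx with
        | edge => cases edge_injective hz
        | pass m' b' hx =>
          cases edge_injective hz
          exact Or.inr (Or.inl (by rwa [Bool.not_not]))
  have hRd : R (Sum.inl (d, j)) := by
    have := congrArg (Quot.lift R fun x y hxy =>
      propext ⟨hR x y hxy, hR y x (arcRel_symm hxy)⟩) h
    exact this.mp (Or.inl rfl)
  rcases hRd with h | h | h
  · exact Or.inl h
  · exact Or.inr h
  -- The walk leaves through `(d, j)`. It continues only through bivalent points, so this is its
  -- start.
  · generalize hz : D.edge (Sum.inl (d, j)) = z at h
    cases h with
    | edge => exact Or.inl (edge_injective hz)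
    | pass m b _ => cases edge_injective hz

theorem Orientation.out_arcJoins (o : D.Orientation) {x y : D.End} (h : D.ArcJoins x y) :
    o.out y = !o.out x := by
  induction h with
  | edge => exact o.out_edge _
  | pass m b _ ih =>
    have : o.out (Sum.inr (m, !b)) = !o.out (Sum.inr (m, b)) := o.out_opp (Sum.inr (m, b))
    rw [o.out_edge, this, ih, Bool.not_not]

/-- An orientation already changes along edges and at bivalent points; only its values at crossings
are wrong. Between the two ends of an arc both `upper` and `out` change, so their discrepancy is a
well-defined bit of the arc, and adding it corrects the orientation. -/
theorem Alternating.exists_isShading (h : D.Alternating) : ∃ k, D.IsShading k := by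
  classical
  obtain ⟨o⟩ : Nonempty D.Orientation := inferInstance
  have hwd : ∀ c i d j, Quot.mk D.arcRel (Sum.inl (c, i)) = Quot.mk _ (Sum.inl (d, j)) →
      xor (upper i) (o.out (Sum.inl (c, i))) = xor (upper j) (o.out (Sum.inl (d, j))) := by
    intro c i d j hcd
    rcases arcJoins_of_arcRel hcd with hcd | hcd
    · cases hcd; rfl
    · have h1 := h c d i j hcd
      rw [o.out_arcJoins hcd]
      revert h1
      cases upper i <;> cases upper j <;> simp
  -- Closed circles without crossings receive the bit `false`.
  let J : Quot D.arcRel → Bool := fun q =>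
    decide (∃ c i, Quot.mk D.arcRel (Sum.inl (c, i)) = q ∧
      xor (upper i) (o.out (Sum.inl (c, i))) = true)
  have hJ : ∀ c i, J (Quot.mk _ (Sum.inl (c, i))) = xor (upper i) (o.out (Sum.inl (c, i))) := by
    intro c i
    rw [Bool.eq_iff_iff, decide_eq_true_iff]
    constructor
    · rintro ⟨d, j, hdj, hj⟩
      rw [← hwd d j c i hdj, hj]
    · exact fun hi => ⟨c, i, rfl, hi⟩
  have hk : ∀ c i, xor (o.out (Sum.inl (c, i))) (J (Quot.mk _ (Sum.inl (c, i)))) = upper i := by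
    intro c i
    rw [hJ]
    cases upper i <;> cases o.out (Sum.inl (c, i)) <;> rfl
  refine ⟨fun x => xor (o.out x) (J (Quot.mk _ x)), ?_, ?_, hk⟩
  · intro x
    have : Quot.mk D.arcRel x = Quot.mk _ (D.edge x) := Quot.sound (Or.inl rfl)
    rw [← this, o.out_edge, Bool.not_xor]
  · rintro (⟨c, i⟩ | ⟨m, b⟩)
    · change xor (o.out (Sum.inl (c, i + 1))) _ = _
      rw [hk, ← upper_add_one, ← hk]; rfl
    · have : Quot.mk D.arcRel (Sum.inr (m, b)) = Quot.mk _ (Sum.inr (m, !b)) :=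
        Quot.sound (Or.inr ⟨m, b, rfl, rfl⟩)
      have h2 : o.out (Sum.inr (m, !b)) = !o.out (Sum.inr (m, b)) := o.out_opp (Sum.inr (m, b))
      change xor (o.out (Sum.inr (m, !b))) (J (Quot.mk _ (Sum.inr (m, !b)))) = _
      rw [← this, h2, Bool.not_xor]

theorem Alternating.smooth (h : D.Alternating) (p : D.Crossing) (s : Bool) :
    (D.smooth p s).Alternating :=
  let ⟨_, hk⟩ := h.exists_isShading
  (hk.smooth p s).alternating

/-! ### Smoothing a shaded connected diagram -/

/-- At most one face is lost, and Euler's inequality for the smoothing demands that at least one is;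
equality there is planarity. -/
theorem Connected.card_face_smooth {p : D.Crossing} {s : Bool} (hP : D.IsPlanar)
    (hD : D.Connected) (hs : (D.smooth p s).Connected) :
    (D.smooth p s).IsPlanar ∧ Nat.card (D.smooth p s).Face + 1 = Nat.card D.Face := by
  have h1 := card_face_le_card_face_smooth p s
  have h2 := card_face_le (D.smooth p s)
  have h3 := card_crossing_smooth p s
  unfold Connected at hD hs
  unfold IsPlanar at hP ⊢
  omega

/-- Relations that preserve colours never leave a colour, so agreement on one colour determines the
classes of that colour. -/
theorem mk_eq_mk_iff_of_color {α : Type*} {r r' : α → α → Prop} (k : α → Bool) (c : Bool)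
    (hr : ∀ x y, r x y → k x = k y) (hr' : ∀ x y, r' x y → k x = k y)
    (h : ∀ x y, k x = c → (r x y ↔ r' x y)) {x y : α} (hx : k x = c) :
    Quot.mk r x = Quot.mk r y ↔ Quot.mk r' x = Quot.mk r' y := by
  have key : ∀ r r' : α → α → Prop, (∀ x y, r x y → k x = k y) →
      (∀ x y, k x = c → r x y → r' x y) → Quot.mk r x = Quot.mk r y →
      Quot.mk r' x = Quot.mk r' y := by
    intro r r' hr h hxy
    have := congrArg (Quot.lift (fun x => if k x = c then some (Quot.mk r' x) else none) (by
      intro x y hxy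
      by_cases hx : k x = c
      · have : Quot.mk r' x = Quot.mk r' y := Quot.sound (h x y hx hxy)
        simp only [hx, ← hr x y hxy, this]
      · simp only [hx, ← hr x y hxy, if_false])) hxy
    change (if k x = c then _ else _) = (if k y = c then _ else _) at this
    rw [if_pos hx] at this
    split_ifs at this
    exact Option.some_injective _ this
  exact ⟨key r r' hr fun x y hx => (h x y hx).1, key r' r hr' fun x y hx => (h x y hx).2⟩

theorem ncard_image_eq_of_iff {α β γ : Type*} (f : α → β) (g : α → γ) (s : Set α)
    (h : ∀ x ∈ s, ∀ y ∈ s, f x = f y ↔ g x = g y) : (f '' s).ncard = (g '' s).ncard := by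
  classical
  refine Set.ncard_congr (fun b hb => g hb.choose) (fun b hb => ⟨_, hb.choose_spec.1, rfl⟩) ?_ ?_
  · intro b b' hb hb' hbb
    rw [← hb.choose_spec.2, ← hb'.choose_spec.2]
    exact (h _ hb.choose_spec.1 _ hb'.choose_spec.1).2 hbb
  · rintro _ ⟨x, hx, rfl⟩
    have hb : f x ∈ f '' s := ⟨x, hx, rfl⟩
    exact ⟨f x, hb, (h _ hb.choose_spec.1 _ hx).1 hb.choose_spec.2⟩

/-- Smoothing with the marker `s` does not affect the faces of the other colour. -/
theorem IsShading.ncard_facesOf_smooth {k : D.End → Bool} (h : D.IsShading k) (p : D.Crossing)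
    (s : Bool) :
    ((D.smooth p s).facesOf (k ∘ D.smoothEquiv p s) (!s)).ncard = (D.facesOf k (!s)).ncard := by
  have hA : k (D.cornerA p s) = s := by
    rw [cornerA, h.crossing]; cases s <;> decide
  have hB : k (D.cornerB p s) = s := by
    rw [cornerB, h.crossing]; cases s <;> decide
  -- The joined corners both have colour `s`, so the transposition preserves colours and fixes all
  -- corners of the other colour.
  have hswap : ∀ x, k (Equiv.swap (D.cornerA p s) (D.cornerB p s) x) = k x := by
    intro x
    rcases eq_or_ne x (D.cornerA p s) with rfl | h1
    · rw [Equiv.swap_apply_left, hA, hB]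
    · rcases eq_or_ne x (D.cornerB p s) with rfl | h2
      · rw [Equiv.swap_apply_right, hA, hB]
      · rw [Equiv.swap_apply_of_ne_of_ne h1 h2]
  have h1 : (D.smoothFaceEquiv p s) '' ((D.smooth p s).facesOf (k ∘ D.smoothEquiv p s) (!s)) =
      Quot.mk (StepRel (D.smoothFaceMap p s)) '' {x | k x = !s} := by
    ext q
    constructor
    · rintro ⟨_, ⟨x, hx, rfl⟩, rfl⟩
      exact ⟨D.smoothEquiv p s x, hx, rfl⟩
    · rintro ⟨x, hx, rfl⟩
      refine ⟨_, ⟨(D.smoothEquiv p s).symm x, ?_, rfl⟩, ?_⟩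
      · simpa using hx
      · change Quot.mk _ (D.smoothEquiv p s ((D.smoothEquiv p s).symm x)) = _
        rw [Equiv.apply_symm_apply]
  rw [← Set.ncard_image_of_injective _ (D.smoothFaceEquiv p s).injective, h1]
  refine ncard_image_eq_of_iff _ D.leftFace _ fun x hx y hy => ?_
  refine mk_eq_mk_iff_of_color k (!s) ?_ ?_ ?_ hx
  · rintro x y rfl
    rw [hswap, h.facePerm]
  · rintro x y rfl
    exact (h.facePerm x).symm
  · intro x y hx
    have hne : ∀ z, k z = s → D.facePerm x ≠ z := by
      rintro z hz rfl
      rw [h.facePerm, hx] at hz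
      simp at hz
    change y = Equiv.swap _ _ _ ↔ y = D.facePerm x
    rw [Equiv.swap_apply_of_ne_of_ne (hne _ hA) (hne _ hB)]

/-- The difference of the numbers of black and white faces. -/
noncomputable def faceDiff (D : LinkDiagram) (k : D.End → Bool) : ℤ :=
  ((D.facesOf k true).ncard : ℤ) - (D.facesOf k false).ncard

/-- The one face lost has colour `s`, since the other colour is unaffected. -/
theorem IsShading.faceDiff_smooth {k : D.End → Bool} (h : D.IsShading k) {p : D.Crossing}
    {s : Bool} (hP : D.IsPlanar) (hD : D.Connected) (hs : (D.smooth p s).Connected) :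
    D.faceDiff k = (D.smooth p s).faceDiff (k ∘ D.smoothEquiv p s) + if s then 1 else -1 := by
  have h1 := (hD.card_face_smooth hP hs).2
  have h2 := h.ncard_facesOf_add
  have h3 := (h.smooth p s).ncard_facesOf_add
  have h4 := h.ncard_facesOf_smooth p s
  unfold faceDiff
  cases s <;> simp at h4 ⊢ <;> omega

theorem IsShading.faceDiff_of_isEmpty_crossing {k : D.End → Bool} (h : D.IsShading k)
    (hP : D.IsPlanar) (hD : D.Connected) [IsEmpty D.Crossing] : D.faceDiff k = 0 := by
  have h2 := h.ncard_facesOf_add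
  unfold IsPlanar at hP
  rw [hD, Fintype.card_eq_zero] at hP
  obtain ⟨⟨x⟩⟩ : Nonempty D.Piece := (Nat.card_pos_iff.1 (by rw [hD]; norm_num)).1
  have hne : ∀ c, 0 < (D.facesOf k c).ncard := by
    intro c
    rw [Set.ncard_pos]
    by_cases hx : k x = c
    · exact ⟨_, x, hx, rfl⟩
    · refine ⟨_, D.edge x, ?_, rfl⟩
      have := h.edge x
      revert this hx
      cases k x <;> cases c <;> simp
  have := hne true
  have := hne false
  unfold faceDiff
  omega

end LinkDiagram

namespace LinkDiagram

variable {D : LinkDiagram}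

/-! ### The bracket at a primitive eighth root of unity -/

theorem bracketAt_eq_sum (D : LinkDiagram) (A : ℂˣ) :
    D.bracketAt A = ∑ s : D.Crossing → Bool,
      (A : ℂ) ^ (∑ c, if s c then (1 : ℤ) else -1) *
        (-(A : ℂ) ^ (2 : ℤ) - (A : ℂ) ^ (-2 : ℤ)) ^ (Nat.card (D.StateCircle s) - 1) := by
  simp only [bracketAt, bracket, map_sum, map_mul, map_pow, map_sub, map_neg,
    LaurentPolynomial.eval₂_T, Units.val_zpow_eq_zpow_val]

/-- The state circles of a diagram are those of the diagram with one crossing smoothed. -/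
theorem card_stateCircle_smooth (p : D.Crossing) (b : Bool) (s : D.Crossing → Bool) (h : s p = b) :
    Nat.card ((D.smooth p b).StateCircle fun c => s c.1) = Nat.card (D.StateCircle s) := by
  subst h
  have key : ∀ x, D.smoothEquiv p (s p) ((D.smooth p (s p)).stateMate (fun c => s c.1) x) =
      D.stateMate s (D.smoothEquiv p (s p) x) := by
    rintro (⟨c, i⟩ | ⟨m | a, b⟩)
    · rfl
    · rfl
    · change Sum.inl (p, arcEnd (s p) a (!b)) =
        (Sum.inl (p, mate (s p) (arcEnd (s p) a b)) : D.End)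
      rw [mate_arcEnd]
  refine Nat.card_congr (Quot.congr (D.smoothEquiv p (s p)) fun x y => ?_)
  rw [← key, ← smoothEquiv_edge, EmbeddingLike.apply_eq_iff_eq, EmbeddingLike.apply_eq_iff_eq]

/-- The skein relation `⟨D⟩ = A ⟨D₀⟩ + A⁻¹ ⟨D_∞⟩`. -/
theorem bracketAt_eq_smooth (D : LinkDiagram) (A : ℂˣ) (p : D.Crossing) :
    D.bracketAt A = (A : ℂ) ^ (1 : ℤ) * (D.smooth p true).bracketAt A +
      (A : ℂ) ^ (-1 : ℤ) * (D.smooth p false).bracketAt A := by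
  have key : ∀ b : Bool, (A : ℂ) ^ (if b then (1 : ℤ) else -1) * (D.smooth p b).bracketAt A =
      ∑ t : {c : D.Crossing // c ≠ p} → Bool,
        (A : ℂ) ^ (∑ c, if (Equiv.funSplitAt p Bool).symm (b, t) c then (1 : ℤ) else -1) *
        (-(A : ℂ) ^ (2 : ℤ) - (A : ℂ) ^ (-2 : ℤ)) ^
          (Nat.card (D.StateCircle ((Equiv.funSplitAt p Bool).symm (b, t))) - 1) := by
    intro b
    rw [bracketAt_eq_sum, Finset.mul_sum]
    refine Finset.sum_congr rfl fun (t : {c : D.Crossing // c ≠ p} → Bool) _ => ?_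
    have h1 : (Equiv.funSplitAt p Bool).symm (b, t) p = b := by
      simp [Equiv.funSplitAt, Equiv.piSplitAt]
    have h2 : ∀ c : {c : D.Crossing // c ≠ p},
        (Equiv.funSplitAt p Bool).symm (b, t) c.1 = t c := by
      intro c
      simp [Equiv.funSplitAt, Equiv.piSplitAt, c.2]
    have h3 : Nat.card ((D.smooth p b).StateCircle t) =
        Nat.card (D.StateCircle ((Equiv.funSplitAt p Bool).symm (b, t))) :=
      (congrArg (fun u => Nat.card ((D.smooth p b).StateCircle u)) (funext h2)).symm.trans
        (card_stateCircle_smooth p b _ h1)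
    have h4 : ∑ c : {c : D.Crossing // c ≠ p},
        (if (Equiv.funSplitAt p Bool).symm (b, t) c.1 then (1 : ℤ) else -1) =
        ∑ c, if t c then (1 : ℤ) else -1 := Finset.sum_congr rfl fun c _ => by rw [h2]
    rw [← h3, Fintype.sum_eq_add_sum_subtype_ne _ p, h1, zpow_add₀ A.ne_zero, mul_assoc, h4]
    rfl
  have h1 := key true
  have h2 := key false
  simp only [if_true, Bool.false_eq_true, if_false] at h1 h2
  rw [h1, h2, bracketAt_eq_sum, ← (Equiv.funSplitAt p Bool).symm.sum_comp,
    Fintype.sum_prod_type, Fintype.sum_bool]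

theorem card_piece_le_card_stateCircle (s : D.Crossing → Bool) :
    Nat.card D.Piece ≤ Nat.card (D.StateCircle s) := by
  have : Finite (D.StateCircle s) := inferInstanceAs (Finite (Quot _))
  refine Nat.card_le_card_of_surjective (Quot.lift (fun x => (Quot.mk _ x : D.Piece)) ?_) ?_
  · rintro x y (rfl | rfl)
    · rcases x with ⟨c, i⟩ | ⟨m, b⟩
      · exact piece_mk_crossing _ _ _
      · exact (piece_mk_rot (Sum.inr (m, b))).symm
    · exact (piece_mk_edge x).symm
  · rintro ⟨x⟩
    exact ⟨Quot.mk _ x, rfl⟩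

theorem loop_value_eq_zero {A : ℂˣ} (hA : (A : ℂ) ^ 4 = -1) :
    -(A : ℂ) ^ (2 : ℤ) - (A : ℂ) ^ (-2 : ℤ) = 0 := by
  have h0 := A.ne_zero
  rw [zpow_neg, zpow_ofNat]
  field_simp
  linear_combination -hA

/-- Every state has at least as many circles as there are pieces, so the vanishing loop value occurs
with a positive exponent. -/
theorem bracketAt_eq_zero {A : ℂˣ} (hA : (A : ℂ) ^ 4 = -1) (hD : 2 ≤ Nat.card D.Piece) :
    D.bracketAt A = 0 := by
  rw [bracketAt_eq_sum, loop_value_eq_zero hA]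
  refine Finset.sum_eq_zero fun s _ => ?_
  have := card_piece_le_card_stateCircle s
  rw [zero_pow (by omega), mul_zero]

/-- The end `x` excludes the empty diagram, which has no pieces and is not connected either. -/
theorem two_le_card_piece_of_not_connected (x : D.End) (h : ¬ D.Connected) :
    2 ≤ Nat.card D.Piece := by
  have : Nonempty D.Piece := ⟨Quot.mk _ x⟩
  have : 0 < Nat.card D.Piece := Nat.card_pos
  unfold Connected at h
  omega

theorem norm_eq_one_of_pow_four {A : ℂˣ} (hA : (A : ℂ) ^ 4 = -1) : ‖(A : ℂ)‖ = 1 := by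
  have : ‖(A : ℂ)‖ ^ 4 = 1 := by rw [← norm_pow, hA, norm_neg, norm_one]
  exact (pow_eq_one_iff_of_nonneg (norm_nonneg _) (by norm_num)).1 this

/-- The bracket of a connected diagram without crossings. -/
theorem bracketAt_of_isEmpty_crossing [IsEmpty D.Crossing] (hD : D.Connected) (A : ℂˣ) :
    D.bracketAt A = 1 := by
  rw [bracketAt_eq_sum, Fintype.sum_unique]
  have : ∀ s, Nat.card (D.StateCircle s) = Nat.card D.Piece := by
    intro s
    refine Nat.card_congr (Quot.congr (Equiv.refl _) fun x y => ?_)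
    rcases x with ⟨c, i⟩ | ⟨m, b⟩
    · exact isEmptyElim c
    · exact Iff.rfl
  rw [this, hD]
  simp

/-- Both skein terms point in the direction of the unit number `A ^ n`, so there is no cancellation.
-/
theorem bracketAt_add_of_smooth {A : ℂˣ} {n : ℤ} (hA : (A : ℂ) ^ 4 = -1) {p : D.Crossing}
    (h : ∀ s : Bool, (A : ℂ) ^ (if s then (1 : ℤ) else -1) * (D.smooth p s).bracketAt A =
      (A : ℂ) ^ n * (‖(D.smooth p s).bracketAt A‖ : ℂ)) :
    D.bracketAt A = (A : ℂ) ^ n * (‖D.bracketAt A‖ : ℂ) ∧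
      ‖D.bracketAt A‖ = ‖(D.smooth p true).bracketAt A‖ + ‖(D.smooth p false).bracketAt A‖ := by
  have h1 := h true
  have h2 := h false
  simp only [if_true, Bool.false_eq_true, if_false] at h1 h2
  have h3 : D.bracketAt A = (A : ℂ) ^ n *
      ((‖(D.smooth p true).bracketAt A‖ + ‖(D.smooth p false).bracketAt A‖ : ℝ) : ℂ) := by
    rw [bracketAt_eq_smooth D A p, h1, h2]; push_cast; ring
  have h4 : ‖D.bracketAt A‖ =
      ‖(D.smooth p true).bracketAt A‖ + ‖(D.smooth p false).bracketAt A‖ := by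
    rw [h3, norm_mul, norm_zpow, norm_eq_one_of_pow_four hA, one_zpow, one_mul,
      Complex.norm_of_nonneg (by positivity)]
  exact ⟨by rw [h4]; exact h3, h4⟩

theorem IsShading.bracketAt_smooth {A : ℂˣ} (hA : (A : ℂ) ^ 4 = -1) {k : D.End → Bool}
    (hk : D.IsShading k) (hP : D.IsPlanar) (hD : D.Connected) (p : D.Crossing) (s : Bool)
    (ih : (D.smooth p s).Connected → (D.smooth p s).bracketAt A =
      (A : ℂ) ^ ((D.smooth p s).faceDiff (k ∘ D.smoothEquiv p s)) *
        (‖(D.smooth p s).bracketAt A‖ : ℂ)) :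
    (A : ℂ) ^ (if s then (1 : ℤ) else -1) * (D.smooth p s).bracketAt A =
      (A : ℂ) ^ D.faceDiff k * (‖(D.smooth p s).bracketAt A‖ : ℂ) := by
  by_cases hs : (D.smooth p s).Connected
  · rw [hk.faceDiff_smooth hP hD hs, add_comm, zpow_add₀ A.ne_zero, mul_assoc, ← ih hs]
  -- A disconnected smoothing has no usable phase, but its bracket is zero.
  · rw [bracketAt_eq_zero hA (two_le_card_piece_of_not_connected
      ((D.smoothEquiv p s).symm (Sum.inl (p, 0))) hs)]
    simp

/-- The phase of the bracket of a connected alternating diagram. -/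
theorem IsShading.bracketAt_eq {A : ℂˣ} (hA : (A : ℂ) ^ 4 = -1) {k : D.End → Bool}
    (hk : D.IsShading k) (hP : D.IsPlanar) (hD : D.Connected) :
    D.bracketAt A = (A : ℂ) ^ D.faceDiff k * (‖D.bracketAt A‖ : ℂ) := by
  induction hn : Fintype.card D.Crossing generalizing D with
  | zero =>
    have := Fintype.card_eq_zero_iff.1 hn
    rw [bracketAt_of_isEmpty_crossing hD, hk.faceDiff_of_isEmpty_crossing hP hD]
    simp
  | succ n ih =>
    obtain ⟨p⟩ : Nonempty D.Crossing := Fintype.card_pos_iff.1 (by omega)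
    refine (bracketAt_add_of_smooth (p := p) hA fun s => ?_).1
    refine hk.bracketAt_smooth hA hP hD p s fun hs => ?_
    have hC := card_crossing_smooth p s
    exact ih (hk.smooth p s) (hD.card_face_smooth hP hs).1 hs (by omega)

theorem Alternating.norm_bracketAt {A : ℂˣ} (hA : (A : ℂ) ^ 4 = -1) (h : D.Alternating)
    (hP : D.IsPlanar) (p : D.Crossing) :
    ‖D.bracketAt A‖ = ‖(D.smooth p true).bracketAt A‖ + ‖(D.smooth p false).bracketAt A‖ := by
  by_cases hD : D.Connected
  · obtain ⟨k, hk⟩ := h.exists_isShading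
    refine (bracketAt_add_of_smooth (n := D.faceDiff k) hA fun s => ?_).2
    exact hk.bracketAt_smooth hA hP hD p s fun hs =>
      (hk.smooth p s).bracketAt_eq hA (hD.card_face_smooth hP hs).1 hs
  · have h2 := two_le_card_piece_of_not_connected (Sum.inl (p, 0)) hD
    rw [bracketAt_eq_zero hA h2,
      bracketAt_eq_zero hA (h2.trans (card_piece_le_card_piece_smooth p true)),
      bracketAt_eq_zero hA (h2.trans (card_piece_le_card_piece_smooth p false))]
    simp

theorem detPoint_pow_four : (detPoint : ℂ) ^ 4 = -1 := by
  change Complex.exp _ ^ 4 = -1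
  rw [← Complex.exp_nat_mul, ← Complex.exp_neg_pi_mul_I]
  congr 1
  push_cast
  ring

theorem absDet_eq_norm_bracketAt (D : LinkDiagram) : D.absDet = ‖D.bracketAt detPoint‖ :=
  norm_det D _

theorem Alternating.absDet_eq (h : D.Alternating) (hP : D.IsPlanar) (p : D.Crossing) :
    D.absDet = (D.smooth p true).absDet + (D.smooth p false).absDet := by
  simp only [absDet_eq_norm_bracketAt]
  exact h.norm_bracketAt detPoint_pow_four hP p

end LinkDiagram

namespace LinkDiagram

variable {D : LinkDiagram}

/-! ### Removing a bivalent point -/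

/-- The ends which are not at the bivalent point `m`. -/
abbrev EndsOff (D : LinkDiagram) (m : D.Bivalent) : Type :=
  {y : D.End // ∀ b, y ≠ Sum.inr (m, b)}

/-- The ends which are not at `m` are the ends at the other vertices. -/
def endsOffEquiv (D : LinkDiagram) (m : D.Bivalent) :
    DiagramEnds D.Crossing {m' : D.Bivalent // m' ≠ m} ≃ D.EndsOff m where
  toFun
    | Sum.inl (c, i) => ⟨Sum.inl (c, i), by simp⟩
    | Sum.inr (m', b) => ⟨Sum.inr (m'.1, b), by simp [m'.2]⟩
  invFun
    | ⟨Sum.inl (c, i), _⟩ => Sum.inl (c, i)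
    | ⟨Sum.inr (m', b), h⟩ => Sum.inr (⟨m', fun hm => h b (by rw [hm])⟩, b)
  left_inv := by rintro (⟨c, i⟩ | ⟨m', b⟩) <;> rfl
  right_inv := by rintro ⟨⟨c, i⟩ | ⟨m', b⟩, h⟩ <;> rfl

/-- The next end along the strand which is not at `m`. -/
def skip (D : LinkDiagram) (m : D.Bivalent) : D.End → D.End
  | Sum.inl (c, i) => Sum.inl (c, i)
  | Sum.inr (m', b) => if m' = m then D.edge (Sum.inr (m, !b)) else Sum.inr (m', b)

theorem skip_inr (m : D.Bivalent) (b : Bool) :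
    D.skip m (Sum.inr (m, b)) = D.edge (Sum.inr (m, !b)) := if_pos rfl

theorem skip_of_ne {m : D.Bivalent} {y : D.End} (h : ∀ b, y ≠ Sum.inr (m, b)) :
    D.skip m y = y := by
  rcases y with ⟨c, i⟩ | ⟨m', b⟩
  · rfl
  · exact if_neg fun hm => h b (by rw [hm])

theorem edge_inr_ne {m : D.Bivalent} (hm : D.edge (Sum.inr (m, false)) ≠ Sum.inr (m, true))
    (b b' : Bool) : D.edge (Sum.inr (m, b)) ≠ Sum.inr (m, b') := by
  have h1 := D.edge_ne (Sum.inr (m, b))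
  have h2 : D.edge (Sum.inr (m, true)) ≠ Sum.inr (m, false) := fun h => hm (by
    rw [← h, D.edge_edge])
  cases b <;> cases b' <;> assumption

theorem skip_ne {m : D.Bivalent} (hm : D.edge (Sum.inr (m, false)) ≠ Sum.inr (m, true))
    (y : D.End) (b : Bool) : D.skip m y ≠ Sum.inr (m, b) := by
  by_cases h : ∃ b', y = Sum.inr (m, b')
  · obtain ⟨b', rfl⟩ := h
    rw [skip_inr]
    exact edge_inr_ne hm _ _
  · push Not at h
    rw [skip_of_ne h]
    exact h b

theorem skip_edge_skip_edge {m : D.Bivalent} {y : D.End} (hy : ∀ b, y ≠ Sum.inr (m, b)) :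
    D.skip m (D.edge (D.skip m (D.edge y))) = y := by
  by_cases h : ∃ b', D.edge y = Sum.inr (m, b')
  · obtain ⟨b', h⟩ := h
    rw [h, skip_inr, D.edge_edge, skip_inr, Bool.not_not, ← h, D.edge_edge]
  · push Not at h
    rw [skip_of_ne h, D.edge_edge, skip_of_ne hy]

theorem skip_edge_ne (m : D.Bivalent) (y : D.End) : D.skip m (D.edge y) ≠ y := by
  by_cases h : ∃ b', D.edge y = Sum.inr (m, b')
  · obtain ⟨b', h⟩ := h
    rw [h, skip_inr]
    intro h'
    rw [← h', D.edge_edge] at h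
    simp at h
  · push Not at h
    rw [skip_of_ne h]
    exact D.edge_ne y

/-- The diagram without the bivalent point `m`. -/
def unsubdivide (D : LinkDiagram) (m : D.Bivalent)
    (hm : D.edge (Sum.inr (m, false)) ≠ Sum.inr (m, true)) : LinkDiagram where
  Crossing := D.Crossing
  Bivalent := {m' : D.Bivalent // m' ≠ m}
  edge x := (D.endsOffEquiv m).symm ⟨D.skip m (D.edge (D.endsOffEquiv m x).1), skip_ne hm _⟩
  edge_edge x := by
    rw [Equiv.symm_apply_eq]
    ext
    simp only [Equiv.apply_symm_apply]
    exact skip_edge_skip_edge (D.endsOffEquiv m x).2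
  edge_ne x h := by
    rw [Equiv.symm_apply_eq] at h
    exact skip_edge_ne m _ (congrArg Subtype.val h)

section Unsubdivide

variable {m : D.Bivalent} (hm : D.edge (Sum.inr (m, false)) ≠ Sum.inr (m, true))

/-- The ends of the diagram without `m` are ends of `D`. -/
def unsubdivideEmb : (D.unsubdivide m hm).End ↪ D.End :=
  (D.endsOffEquiv m).toEmbedding.trans (Function.Embedding.subtype _)

theorem unsubdivideEmb_ne (x : (D.unsubdivide m hm).End) (b : Bool) :
    unsubdivideEmb hm x ≠ Sum.inr (m, b) := (D.endsOffEquiv m x).2 b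

theorem exists_unsubdivideEmb_eq {y : D.End} (hy : ∀ b, y ≠ Sum.inr (m, b)) :
    ∃ x, unsubdivideEmb hm x = y :=
  ⟨(D.endsOffEquiv m).symm ⟨y, hy⟩, congrArg Subtype.val ((D.endsOffEquiv m).apply_symm_apply _)⟩

theorem unsubdivideEmb_edge (x : (D.unsubdivide m hm).End) :
    unsubdivideEmb hm ((D.unsubdivide m hm).edge x) =
      D.skip m (D.edge (unsubdivideEmb hm x)) :=
  congrArg Subtype.val ((D.endsOffEquiv m).apply_symm_apply _)

theorem unsubdivideEmb_rot (x : (D.unsubdivide m hm).End) :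
    unsubdivideEmb hm ((D.unsubdivide m hm).rot x) = D.rot (unsubdivideEmb hm x) := by
  rcases x with ⟨c, i⟩ | ⟨m', b⟩ <;> rfl

theorem unsubdivideEmb_rotInv (x : (D.unsubdivide m hm).End) :
    unsubdivideEmb hm ((D.unsubdivide m hm).rotInv x) = D.rotInv (unsubdivideEmb hm x) := by
  rcases x with ⟨c, i⟩ | ⟨m', b⟩ <;> rfl

theorem subdivision_unsubdivide : Subdivision (D.unsubdivide m hm) D := by
  obtain ⟨x, hx⟩ := exists_unsubdivideEmb_eq hm (edge_inr_ne hm false)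
  have hx' : unsubdivideEmb hm ((D.unsubdivide m hm).edge x) = D.edge (Sum.inr (m, true)) := by
    rw [unsubdivideEmb_edge, hx, D.edge_edge, skip_inr, Bool.not_false]
  refine ⟨unsubdivideEmb hm, m, x, fun y => ⟨?_, exists_unsubdivideEmb_eq hm⟩,
    unsubdivideEmb_rot hm, ?_, ?_, ?_, ?_⟩
  · rintro ⟨z, rfl⟩
    exact unsubdivideEmb_ne hm z
  · rintro (⟨c, i⟩ | ⟨m', b⟩) <;> rfl
  · rw [hx, D.edge_edge]
  · rw [hx', D.edge_edge]
  · intro y hy hy'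
    rw [unsubdivideEmb_edge, skip_of_ne]
    rintro b hb
    have h1 : unsubdivideEmb hm y = D.edge (Sum.inr (m, b)) := by rw [← hb, D.edge_edge]
    cases b
    · exact hy ((unsubdivideEmb hm).injective (h1.trans hx.symm))
    · exact hy' ((unsubdivideEmb hm).injective (h1.trans hx'.symm))

theorem IsShading.unsubdivide {k : D.End → Bool} (hk : D.IsShading k) :
    (D.unsubdivide m hm).IsShading (k ∘ unsubdivideEmb hm) where
  edge x := by
    simp only [Function.comp, unsubdivideEmb_edge]
    by_cases h : ∃ b', D.edge (unsubdivideEmb hm x) = Sum.inr (m, b')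
    · obtain ⟨b', h⟩ := h
      have h1 : k (Sum.inr (m, !b')) = !k (Sum.inr (m, b')) := hk.rot (Sum.inr (m, b'))
      rw [h, skip_inr, hk.edge, h1, ← h, hk.edge, Bool.not_not]
    · push Not at h
      rw [skip_of_ne h, hk.edge]
  rot x := by simp only [Function.comp, unsubdivideEmb_rot, hk.rot]
  crossing c i := hk.crossing c i

theorem connected_unsubdivide (hD : D.Connected) : (D.unsubdivide m hm).Connected := by
  classical
  -- `g` retracts the ends of `D` onto the remaining ones, moving an end at `m` across its edge. It
  -- induces a surjection on pieces.
  choose g hg using fun y : D.End => exists_unsubdivideEmb_eq (y :=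
    if ∃ b, y = Sum.inr (m, b) then D.edge y else y) hm (by
      split_ifs with h
      · obtain ⟨b, rfl⟩ := h
        exact edge_inr_ne hm b
      · push Not at h
        exact h)
  have hgm : ∀ b, unsubdivideEmb hm (g (Sum.inr (m, b))) = D.edge (Sum.inr (m, b)) := by
    intro b
    rw [hg, if_pos ⟨b, rfl⟩]
  have hgn : ∀ y, (∀ b, y ≠ Sum.inr (m, b)) → unsubdivideEmb hm (g y) = y := by
    intro y hy
    rw [hg, if_neg (by push Not; exact hy)]
  have hgf : ∀ x, g (unsubdivideEmb hm x) = x := fun x =>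
    (unsubdivideEmb hm).injective (hgn _ (unsubdivideEmb_ne hm x))
  have hflip : ∀ b, (D.unsubdivide m hm).edge (g (Sum.inr (m, b))) = g (Sum.inr (m, !b)) := by
    intro b
    apply (unsubdivideEmb hm).injective
    rw [unsubdivideEmb_edge, hgm, hgm, D.edge_edge, skip_inr]
  let G : D.Piece → (D.unsubdivide m hm).Piece := Quot.lift (fun y => Quot.mk _ (g y)) (by
    rintro x y (rfl | rfl)
    · by_cases h : ∃ b, x = Sum.inr (m, b)
      · obtain ⟨b, rfl⟩ := h
        rw [← piece_mk_edge, hflip]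
        rfl
      · push Not at h
        obtain ⟨z, rfl⟩ := exists_unsubdivideEmb_eq hm h
        rw [← unsubdivideEmb_rot, hgf, hgf, piece_mk_rot]
    · by_cases h : ∃ b, x = Sum.inr (m, b)
      · obtain ⟨b, rfl⟩ := h
        congr 1
        apply (unsubdivideEmb hm).injective
        rw [hgm, hgn _ (edge_inr_ne hm b)]
      · push Not at h
        obtain ⟨z, rfl⟩ := exists_unsubdivideEmb_eq hm h
        rw [hgf]
        by_cases h' : ∃ b, D.edge (unsubdivideEmb hm z) = Sum.inr (m, b)
        · obtain ⟨b, h'⟩ := h'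
          congr 1
          apply (unsubdivideEmb hm).injective
          rw [h', hgm, ← h', D.edge_edge]
        · push Not at h'
          rw [← piece_mk_edge z]
          congr 1
          apply (unsubdivideEmb hm).injective
          rw [hgn _ h', unsubdivideEmb_edge, skip_of_ne h'])
  have hG : Function.Surjective G := by
    rintro ⟨x⟩
    exact ⟨Quot.mk _ (unsubdivideEmb hm x), congrArg (Quot.mk _) (hgf x)⟩
  have h1 := Nat.card_le_card_of_surjective G hG
  have h2 : Nonempty (D.unsubdivide m hm).Piece := ⟨Quot.mk _ (g (Sum.inr (m, true)))⟩
  have h3 : 0 < Nat.card (D.unsubdivide m hm).Piece := Nat.card_pos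
  unfold Connected at hD ⊢
  omega

theorem card_face_le_card_face_unsubdivide :
    Nat.card D.Face ≤ Nat.card (D.unsubdivide m hm).Face := by
  refine Nat.card_le_card_of_surjective
    (Quot.lift (fun x => D.leftFace (unsubdivideEmb hm x)) ?_) ?_
  · rintro x y rfl
    rw [unsubdivideEmb_rotInv, unsubdivideEmb_edge]
    by_cases h : ∃ b, D.edge (unsubdivideEmb hm x) = Sum.inr (m, b)
    · obtain ⟨b, h⟩ := h
      rw [h, skip_inr, leftFace_rotInv_edge, ← leftFace_rotInv_edge (unsubdivideEmb hm x), h]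
      rfl
    · push Not at h
      rw [skip_of_ne h, leftFace_rotInv_edge]
  · rintro ⟨y⟩
    by_cases h : ∃ b, y = Sum.inr (m, b)
    · obtain ⟨b, rfl⟩ := h
      obtain ⟨x, hx⟩ := exists_unsubdivideEmb_eq hm (edge_inr_ne hm (!b))
      refine ⟨Quot.mk _ x, ?_⟩
      change D.leftFace (unsubdivideEmb hm x) = D.leftFace (Sum.inr (m, b))
      rw [hx, ← leftFace_rotInv_edge, D.edge_edge]
      simp [LinkDiagram.rotInv]
    · push Not at h
      obtain ⟨x, rfl⟩ := exists_unsubdivideEmb_eq hm h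
      exact ⟨Quot.mk _ x, rfl⟩

/-- The faces of the new diagram map onto those of `D`, and Euler's inequality bounds their number
from above by the planar value. -/
theorem isPlanar_unsubdivide (hP : D.IsPlanar) (hD : D.Connected) :
    (D.unsubdivide m hm).IsPlanar := by
  have h1 := card_face_le_card_face_unsubdivide hm
  have h2 := card_face_le (D.unsubdivide m hm)
  have h3 := connected_unsubdivide hm hD
  have h4 : Fintype.card (D.unsubdivide m hm).Crossing = Fintype.card D.Crossing := rfl
  unfold Connected at hD h3
  unfold IsPlanar at hP ⊢
  omega

theorem card_bivalent_unsubdivide :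
    Fintype.card (D.unsubdivide m hm).Bivalent < Fintype.card D.Bivalent :=
  Fintype.card_subtype_lt (p := fun m' => m' ≠ m) (x := m) (by simp)

end Unsubdivide

theorem Connected.mk_eq_mk (hD : D.Connected) (x y : D.End) :
    (Quot.mk _ x : D.Piece) = Quot.mk _ y := by
  exact (Nat.card_eq_one_iff_unique.1 hD).1.elim _ _

/-- In a connected diagram with a crossing no edge joins the two ends at a bivalent point. -/
theorem Connected.edge_inr_ne (hD : D.Connected) (c : D.Crossing) (m : D.Bivalent) :
    D.edge (Sum.inr (m, false)) ≠ Sum.inr (m, true) := by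
  intro h
  have h' : D.edge (Sum.inr (m, true)) = Sum.inr (m, false) := by rw [← h, D.edge_edge]
  -- Otherwise the two ends at `m` would form a circle of their own, apart from the crossing `c`.
  let R : D.End → Prop := fun y => ∃ b, y = Sum.inr (m, b)
  have hrot : ∀ x, R x → R (D.rot x) := by
    rintro _ ⟨b, rfl⟩
    exact ⟨!b, rfl⟩
  have hrotInv : ∀ x, R x → R (D.rotInv x) := by
    rintro _ ⟨b, rfl⟩
    exact ⟨!b, rfl⟩
  have hedge : ∀ x, R x → R (D.edge x) := by
    rintro _ ⟨b, rfl⟩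
    cases b
    · exact ⟨true, h⟩
    · exact ⟨false, h'⟩
  have := congrArg (Quot.lift R (by
    rintro x y (rfl | rfl)
    · exact propext ⟨hrot x, fun hx => by simpa [rotInv_rot] using hrotInv _ hx⟩
    · exact propext ⟨hedge x, fun hx => by simpa [D.edge_edge] using hedge _ hx⟩))
    (hD.mk_eq_mk (Sum.inr (m, true)) (Sum.inl (c, 0)))
  obtain ⟨b, hb⟩ := this.mp ⟨true, rfl⟩
  cases hb

/-! ### Diagrams all of whose crossings are nugatory -/

theorem Connected.smooth_of_eq (hD : D.Connected) {p : D.Crossing} {s : Bool}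
    (h : Quot.mk (D.smoothRel p s) (D.cornerA p s) = Quot.mk _ (D.cornerB p s)) :
    (D.smooth p s).Connected := by
  unfold Connected
  rw [card_piece_smooth_of_eq h, hD]

/-- Opposite ends lie on the two different arcs, which a disconnecting smoothing puts in different
pieces. -/
theorem mk_ne_mk_add_two (hD : D.Connected) {p : D.Crossing} {s : Bool}
    (hs : ¬ (D.smooth p s).Connected) (i : ZMod 4) :
    Quot.mk (D.smoothRel p s) (Sum.inl (p, i)) ≠ Quot.mk _ (Sum.inl (p, i + 2)) := by
  have hne : ∀ j, j = (if s then (1 : ZMod 4) else 0) ∨ j = (if s then 3 else 2) →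
      Quot.mk (D.smoothRel p s) (Sum.inl (p, j)) ≠ Quot.mk _ (Sum.inl (p, j + 2)) := by
    intro j hj h
    refine hs (hD.smooth_of_eq ?_)
    unfold cornerA cornerB
    rcases hj with rfl | rfl
    · rw [h]; cases s <;> rfl
    · rw [h]; cases s <;> rfl
  intro h
  have key : ∀ (s : Bool) (i : ZMod 4), (i = (if s then (1 : ZMod 4) else 0) ∨
      i = (if s then 3 else 2)) ∨ ((mate s i = (if s then (1 : ZMod 4) else 0) ∨
      mate s i = (if s then 3 else 2)) ∧ mate s i + 2 = mate s (i + 2)) := by decide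
  rcases key s i with hi | ⟨hi, hi'⟩
  · exact hne i hi h
  · refine hne _ hi ?_
    rw [hi', smoothRel_mk_mate, smoothRel_mk_mate, h]

/-- A crossing `q` in a piece cut off by a nugatory crossing `p` cuts off a smaller piece, if it is
nugatory. -/
theorem exists_smaller_piece (hD : D.Connected) {p q : D.Crossing} {s t : Bool} {i l : ZMod 4}
    (hqp : q ≠ p) (ht : ¬ (D.smooth q t).Connected)
    (hl : Quot.mk (D.smoothRel p s) (Sum.inl (q, l)) = Quot.mk _ (Sum.inl (p, i))) :
    ∃ j, {y | Quot.mk (D.smoothRel q t) y = Quot.mk _ (Sum.inl (q, j))} ⊂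
      {y | Quot.mk (D.smoothRel p s) y = Quot.mk _ (Sum.inl (p, i))} := by
  classical
  have hq : ∀ l', Quot.mk (D.smoothRel p s) (Sum.inl (q, l')) = Quot.mk _ (Sum.inl (p, i)) :=
    fun l' => (smoothRel_mk_crossing s hqp l' l).trans hl
  -- Of the two pieces at `q`, one avoids `p`. Its connections never use `p`, so it lies in the old
  -- piece, and it misses the end opposite to `(q, j)`.
  obtain ⟨j, hj⟩ : ∃ j, Quot.mk (D.smoothRel q t) (Sum.inl (p, 0)) ≠ Quot.mk _ (Sum.inl (q, j)) := by
    by_contra! h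
    exact mk_ne_mk_add_two hD ht 0 ((h 0).symm.trans (h (0 + 2)))
  refine ⟨j, Set.ssubset_iff_subset_ne.2 ⟨?_, ?_⟩⟩
  · intro y (hy : Quot.mk (D.smoothRel q t) y = Quot.mk _ (Sum.inl (q, j)))
    let R : D.End → Option (Quot (D.smoothRel p s)) := fun y =>
      if Quot.mk (D.smoothRel q t) y = Quot.mk _ (Sum.inl (q, j)) then some (Quot.mk _ y) else none
    have hR : ∀ x y, D.smoothRel q t x y → R x = R y := by
      intro x y hxy
      have h1 : Quot.mk (D.smoothRel q t) x = Quot.mk _ y := Quot.sound hxy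
      simp only [R, ← h1]
      split_ifs with hx
      · congr 1
        rcases hxy with rfl | rfl
        · rcases x with ⟨c, a⟩ | ⟨m, b⟩
          · by_cases hc : c = q
            · subst hc
              simp only [smoothRot, if_true]
              rw [hq, hq]
            · simp only [smoothRot, if_neg hc]
              have hcp : c ≠ p := by
                rintro rfl
                exact hj ((smoothRel_mk_crossing t hc 0 a).trans hx)
              exact smoothRel_mk_crossing s hcp _ _
          · exact (smoothRel_mk_smoothRot p s (Sum.inr (m, b))).symm
        · exact (smoothRel_mk_edge p s x).symm
      · rfl
    have h2 := congrArg (Quot.lift R hR) hy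
    change R y = R (Sum.inl (q, j)) at h2
    simp only [R, hy, if_true] at h2
    exact (Option.some_injective _ h2).trans (hq j)
  · intro h
    have h2 : (Sum.inl (q, j + 2) : D.End) ∈
        {y | Quot.mk (D.smoothRel p s) y = Quot.mk _ (Sum.inl (p, i))} := hq _
    rw [← h] at h2
    exact mk_ne_mk_add_two hD ht j h2.symm

/-- A connected diagram without bivalent points, all of whose crossings are nugatory,
has a kink. -/
theorem exists_kink [IsEmpty D.Bivalent] [Nonempty D.Crossing] (hD : D.Connected)
    (h : ∀ p : D.Crossing, ∃ s, ¬ (D.smooth p s).Connected) :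
    ∃ (p : D.Crossing) (s : Bool) (i : ZMod 4),
      D.edge (Sum.inl (p, i)) = Sum.inl (p, i + 1) ∧ mate s i = i - 1 := by
  -- A smallest piece cut off by a nugatory crossing contains no other crossing.
  let T : Type := {a : D.Crossing × Bool × ZMod 4 // ¬ (D.smooth a.1 a.2.1).Connected}
  let X : T → Set D.End := fun a =>
    {y | Quot.mk (D.smoothRel a.1.1 a.1.2.1) y = Quot.mk _ (Sum.inl (a.1.1, a.1.2.2))}
  have : Nonempty T := by
    obtain ⟨p⟩ := ‹Nonempty D.Crossing›
    obtain ⟨s, hs⟩ := h p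
    exact ⟨⟨(p, s, 0), hs⟩⟩
  have : Finite T := inferInstanceAs (Finite (Subtype _))
  obtain ⟨⟨⟨p, s, i⟩, hs⟩, hmin⟩ := Finite.exists_min fun a : T => (X a).ncard
  have hp : ∀ q l, Quot.mk (D.smoothRel p s) (Sum.inl (q, l)) = Quot.mk _ (Sum.inl (p, i)) →
      q = p := by
    intro q l hl
    by_contra hqp
    obtain ⟨t, ht⟩ := h q
    obtain ⟨j, hj⟩ := exists_smaller_piece hD hqp ht hl
    have h1 := Set.ncard_lt_ncard hj
    have h2 := hmin ⟨(q, t, j), ht⟩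
    exact absurd h1 (not_lt.2 h2)
  -- The edge from `(p, i)` must end at `p` and in the same piece, which excludes `i + 2` and its
  -- mate.
  have hedge : D.edge (Sum.inl (p, i)) = Sum.inl (p, mate s i) := by
    have h1 := smoothRel_mk_edge p s (Sum.inl (p, i))
    have h2 := D.edge_ne (Sum.inl (p, i))
    rcases h3 : D.edge (Sum.inl (p, i)) with ⟨q, l⟩ | ⟨m, b⟩
    · rw [h3] at h1 h2
      obtain rfl := hp q l h1
      have hl : l ≠ i := fun hl => h2 (by rw [hl])
      have hl2 : l ≠ i + 2 := by
        rintro rfl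
        exact mk_ne_mk_add_two hD hs i h1.symm
      have hl3 : l ≠ mate s i + 2 := by
        rintro rfl
        have h4 := mk_ne_mk_add_two hD hs (mate s i)
        rw [h1, smoothRel_mk_mate] at h4
        exact h4 rfl
      have key : ∀ (s : Bool) (i l : ZMod 4), l ≠ i → l ≠ i + 2 → l ≠ mate s i + 2 →
          l = mate s i := by decide
      rw [key s i l hl hl2 hl3]
    · exact isEmptyElim m
  -- The marker `s` cuts off the loop, so the opposite marker removes the kink.
  have key : ∀ (s : Bool) (i : ZMod 4), (mate s i = i + 1 ∧ mate (!s) i = i - 1) ∨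
      (i = mate s i + 1 ∧ mate (!s) (mate s i) = mate s i - 1) := by decide
  rcases key s i with ⟨h1, h2⟩ | ⟨h1, h2⟩
  · exact ⟨p, !s, i, by rw [hedge, h1], h2⟩
  · refine ⟨p, !s, mate s i, ?_, h2⟩
    rw [← h1, ← hedge, D.edge_edge]

/-- Removing a kink keeps the diagram connected. -/
theorem Connected.smooth_kink (hD : D.Connected) {p : D.Crossing} {s : Bool} {i : ZMod 4}
    (h : D.edge (Sum.inl (p, i)) = Sum.inl (p, i + 1)) (hs : mate s i = i - 1) :
    (D.smooth p s).Connected := by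
  by_contra hn
  have h1 := smoothRel_mk_edge p s (Sum.inl (p, i))
  have h2 := smoothRel_mk_mate p s (i + 1)
  have key : ∀ (s : Bool) (i : ZMod 4), mate s i = i - 1 → mate s (i + 1) = i + 2 := by decide
  rw [key s i hs] at h2
  rw [h] at h1
  exact mk_ne_mk_add_two hD hn i (h2.trans h1).symm

/-! ### Alternating links are quasi-alternating -/

theorem equivalent_of_move {D' : LinkDiagram} (h : Move D D') : Equivalent D D' :=
  Relation.EqvGen.rel _ _ h

theorem Equivalent.symm {D' : LinkDiagram} (h : Equivalent D D') : Equivalent D' D :=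
  Relation.EqvGen.symm _ _ h

theorem Equivalent.isPlanar_iff {D' : LinkDiagram} (h : Equivalent D D') :
    D.IsPlanar ↔ D'.IsPlanar := by
  induction h with
  | rel _ _ h => exact ⟨fun _ => h.2.1, fun _ => h.1⟩
  | refl => exact Iff.rfl
  | symm _ _ _ ih => exact ih.symm
  | trans _ _ _ _ _ ih₁ ih₂ => exact ih₁.trans ih₂

/-- Connectedness of the diagram replaces non-splitness of the link as the induction hypothesis,
since it is directly checked for smoothings. -/
theorem Alternating.quasiAlternating (D : LinkDiagram) (hA : D.Alternating) (hP : D.IsPlanar)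
    (hD : D.Connected) : D.QuasiAlternating := by
  rcases isEmpty_or_nonempty D.Crossing with hC | ⟨⟨c⟩⟩
  · exact .trivialKnot D hP hC hD
  rcases isEmpty_or_nonempty D.Bivalent with hM | ⟨⟨m⟩⟩
  · by_cases h : ∃ p : D.Crossing, ∀ s, (D.smooth p s).Connected
    · obtain ⟨p, hp⟩ := h
      have h1 := card_crossing_smooth p true
      have h2 := card_crossing_smooth p false
      exact .crossing D p hP
        (Alternating.quasiAlternating _ (hA.smooth p true) (hD.card_face_smooth hP (hp true)).1
          (hp true))
        (Alternating.quasiAlternating _ (hA.smooth p false) (hD.card_face_smooth hP (hp false)).1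
          (hp false))
        (hA.absDet_eq hP p)
    · push Not at h
      have : Nonempty D.Crossing := ⟨c⟩
      obtain ⟨p, s, i, hi, hs⟩ := exists_kink hD h
      have h1 := card_crossing_smooth p s
      have hc := hD.smooth_kink hi hs
      have hp := (hD.card_face_smooth hP hc).1
      refine .isotopy (D.smooth p s) D ?_
        (Alternating.quasiAlternating _ (hA.smooth p s) hp hc)
      exact (equivalent_of_move
        ⟨hP, hp, Or.inr (Or.inr (Or.inl ⟨p, i, s, hi, hs, rfl⟩))⟩).symm
  · have hm := hD.edge_inr_ne c m
    have h1 := card_bivalent_unsubdivide hm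
    have hp := isPlanar_unsubdivide hm hP hD
    obtain ⟨k, hk⟩ := hA.exists_isShading
    refine .isotopy (D.unsubdivide m hm) D
      (equivalent_of_move ⟨hp, hP, Or.inr (Or.inl (subdivision_unsubdivide hm))⟩)
      (Alternating.quasiAlternating _ (hk.unsubdivide hm).alternating hp
        (connected_unsubdivide hm hD))
-- Smoothing creates two bivalent points, so crossings must come first in the lexicographic order.
termination_by (Fintype.card D.Crossing, Fintype.card D.Bivalent)
decreasing_by
  all_goals first
    | exact Prod.Lex.left _ _ (by omega)
    | exact Prod.Lex.right _ h1

end LinkDiagram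

/-! ### The three statements of the lemma. -/

theorem lemma7p7 :
    (∀ (A : ℂˣ), (A : ℂ) ^ 4 = -1 →
      ∀ (D : LinkDiagram), D.IsPlanar → D.Alternating →
        (D.Connected →
          (∃ S, D.IsStandardShading S) ∧
          ∀ S, D.IsStandardShading S →
            D.bracketAt A =
              (A : ℂ) ^ ((S.ncard : ℤ) - (Sᶜ.ncard : ℤ)) * (‖D.bracketAt A‖ : ℂ)) ∧
        (∀ p : D.Crossing,
          ‖D.bracketAt A‖ =
            ‖(D.smooth p true).bracketAt A‖ + ‖(D.smooth p false).bracketAt A‖)) ∧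
    (∀ (D : LinkDiagram), D.IsPlanar → D.Alternating → ∀ p : D.Crossing,
        D.absDet = (D.smooth p true).absDet + (D.smooth p false).absDet) ∧
    (∀ (D : LinkDiagram), D.IsPlanar → D.NonSplitLink → D.AlternatingLink →
        D.QuasiAlternating) := by
  refine ⟨fun A hA D hP hD => ⟨fun hc => ⟨?_, ?_⟩, hD.norm_bracketAt hA hP⟩,
    fun D hP hD p => hD.absDet_eq hP p, ?_⟩
  · obtain ⟨k, hk⟩ := hD.exists_isShading
    exact ⟨_, hk.isStandardShading⟩
  · intro S hS
    obtain ⟨k, hk, rfl⟩ := hS.exists_isShading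
    rw [hk.compl_facesOf]
    exact hk.bracketAt_eq hA hP hc
  · rintro D hP hN ⟨D', hDD', hD'⟩
    exact .isotopy D' D hDD'.symm
      (hD'.quasiAlternating D' (hDD'.isPlanar_iff.1 hP) (hN D' hDD'))
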